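/- Let $k$ be a field and $n\ge 0$ an integer. Let $\mathbb{T}(n)$ be the Tamari lattice of degree $n$: the set of planar binary trees with $n$ trivalent vertices, ordered by the reflexive and transitive closure of the elementary rotations replacing, anywhere in a tree, a configuration $(a\wedge b)\wedge c$ by $a\wedge(b\wedge c)$ (here $a\wedge b$ is the tree whose root vertex has left subtree $a$ and right subtree $b$). Let $\operatorname{mod}(\mathbb{T}(n))$ be the abelian category of finite-dimensional modules over $\mathbb{T}(n)$, that is, of families of finite-dimensional $k$-vector spaces $(M_v)_{v\in\mathbb{T}(n)}$ with linear maps $M_v\to M_w$ for $v\le w$, compatible with composition. Let $\mathcal{D}=\mathcal{D}\operatorname{mod}(\mathbb{T}(n))$ be its bounded derived category and let $K_0(\mathcal{D})$ be the Grothendieck group of the triangulated category $\mathcal{D}$. The Auslander–Reiten translation of $\mathcal{D}$ is the self-equivalence $\tau$ of $\mathcal{D}$, unique up to isomorphism, for which there are isomorphisms of $k$-vector spaces $\operatorname{Hom}(Y,(\tau X)[1])\cong\operatorname{Hom}(X,Y)^*$, natural in $X$ and $Y$. The Coxeter transformation $\theta$ is the endomorphism of $K_0(\mathcal{D})$ induced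 by $\tau$, i.e. $\theta([X])=[\tau X]$ for every object $X$ of $\mathcal{D}$. Then $\theta$ is well defined (the translation $\tau$ exists and induces exactly one endomorphism of $K_0(\mathcal{D})$, which does not depend on the choice of $\tau$), and $$\theta^{2n+2}=\mathrm{Id}.$$ -/

import Mathlib

open CategoryTheory CategoryTheory.Limits CategoryTheory.Pretriangulated

universe w u

namespace TamariCoxeter

/-! ### Tamari posets -/

/-- One elementary rotation of planar binary trees: somewhere in the tree, a configuration
`(a ∧ b) ∧ c` is replaced by `a ∧ (b ∧ c)`. Here `BinaryTree.nil` is the tree without vertices and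
`BinaryTree.node () a b` is the tree whose root vertex has left subtree `a` and right subtree `b`. -/
inductive Rotation : BinaryTree Unit → BinaryTree Unit → Prop
  | rot (a b c : BinaryTree Unit) :
      Rotation (.node () (.node () a b) c) (.node () a (.node () b c))
  | left {a a' : BinaryTree Unit} (b : BinaryTree Unit) (h : Rotation a a') :
      Rotation (.node () a b) (.node () a' b)
  | right (a : BinaryTree Unit) {b b' : BinaryTree Unit} (h : Rotation b b') :
      Rotation (.node () a b) (.node () a b')

/-- Sum over all vertices of the number of vertices of the left subtree. -/
def leftWeight : BinaryTree Unit → ℕ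
  | .nil => 0
  | .node _ a b => a.numNodes + leftWeight a + leftWeight b

theorem Rotation.numNodes_eq {s t : BinaryTree Unit} (h : Rotation s t) :
    s.numNodes = t.numNodes := by
  induction h <;> simp only [BinaryTree.numNodes] <;> omega

theorem Rotation.leftWeight_lt {s t : BinaryTree Unit} (h : Rotation s t) :
    leftWeight t < leftWeight s := by
  induction h with
  | rot a b c => simp only [leftWeight, BinaryTree.numNodes]; omega
  | left b h ih => have := h.numNodes_eq; simp only [leftWeight]; omega
  | right a h ih => simp only [leftWeight]; omega

theorem eq_or_leftWeight_lt {s t : BinaryTree Unit} (h : Relation.ReflTransGen Rotation s t) :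
    s = t ∨ leftWeight t < leftWeight s := by
  induction h with
  | refl => exact Or.inl rfl
  | tail _ h ih =>
    have := h.leftWeight_lt
    rcases ih with rfl | ih
    · exact Or.inr this
    · exact Or.inr (this.trans ih)

/-- The Tamari poset of degree `n`: planar binary trees with `n` (inner) vertices. -/
def Tamari (n : ℕ) : Type := {t : BinaryTree Unit // t.numNodes = n}

/-- The Tamari order is the reflexive and transitive closure of the elementary rotations
(a rotation does not change the number of vertices, so all intermediate trees have degree `n`). -/
instance (n : ℕ) : PartialOrder (Tamari n) where
  le s t := Relation.ReflTransGen Rotation s.1 t.1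
  le_refl _ := Relation.ReflTransGen.refl
  le_trans _ _ _ h h' := Relation.ReflTransGen.trans h h'
  le_antisymm s t h h' := by
    apply Subtype.ext
    rcases eq_or_leftWeight_lt h with h | h
    · exact h
    · rcases eq_or_leftWeight_lt h' with h' | h'
      · exact h'.symm
      · omega

/-! ### Modules over a poset and their bounded derived category -/

/-- The category of (finite-dimensional) modules over a poset `P`: a finite-dimensional vector
space `M v` for each `v : P` and linear maps `M v → M w` for `v ≤ w`, compatible with composition.
For finite `P` the maps are determined by those along the covering relations, i.e. by a
representation of the Hasse quiver of `P` in which any two parallel paths act in the same way. -/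
abbrev PosetMod (k : Type u) [Field k] (P : Type) [PartialOrder P] : Type (u + 1) :=
  P ⥤ FGModuleCat.{u} k

/-! ### The Grothendieck group of a triangulated category -/

section GrothendieckGroup

variable (D : Type*) [Category D] [HasZeroObject D] [Preadditive D] [HasShift D ℤ]
  [∀ n : ℤ, (shiftFunctor D n).Additive] [Pretriangulated D]

/-- The relations `[Y] = [X] + [Z]`, one for each distinguished triangle `X ⟶ Y ⟶ Z ⟶ X⟦1⟧`. -/
def k0Relations : AddSubgroup (FreeAbelianGroup D) :=
  AddSubgroup.closure
    {x | ∃ T ∈ distTriang D, x = FreeAbelianGroup.of T.obj₂ -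
      (FreeAbelianGroup.of T.obj₁ + FreeAbelianGroup.of T.obj₃)}

/-- The Grothendieck group of a triangulated category. -/
abbrev K0 := FreeAbelianGroup D ⧸ k0Relations D

variable {D}

/-- The class of an object in the Grothendieck group. -/
def K0.of (X : D) : K0 D := QuotientAddGroup.mk (FreeAbelianGroup.of X)

end GrothendieckGroup

/-! ### The Auslander-Reiten translation and the Coxeter transformation -/

section AuslanderReiten

variable (k : Type*) [Field k] {D : Type*} [Category D] [HasZeroObject D] [Preadditive D]
  [Linear k D] [HasShift D ℤ] [∀ n : ℤ, (shiftFunctor D n).Additive] [Pretriangulated D]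

/-- A self-equivalence `τ` of a `k`-linear triangulated category is an Auslander-Reiten translation
if `X ↦ (τ X)⟦1⟧` is a Serre functor: there are isomorphisms `Hom(Y, (τ X)⟦1⟧) ≅ Hom(X, Y)^*`
of `k`-vector spaces, natural in `X` and `Y`. (This determines `τ` up to isomorphism.) -/
structure IsAuslanderReitenTranslation (τ : D ⥤ D) : Prop where
  isEquivalence : τ.IsEquivalence
  duality : ∃ η : ∀ X Y : D, (Y ⟶ (τ.obj X)⟦(1 : ℤ)⟧) ≃ₗ[k] Module.Dual k (X ⟶ Y),
    (∀ (X Y Y' : D) (g : Y' ⟶ Y) (φ : Y ⟶ (τ.obj X)⟦(1 : ℤ)⟧) (f : X ⟶ Y'),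
      η X Y' (g ≫ φ) f = η X Y φ (f ≫ g)) ∧
    (∀ (X X' Y : D) (a : X ⟶ X') (φ : Y ⟶ (τ.obj X)⟦(1 : ℤ)⟧) (f : X' ⟶ Y),
      η X' Y (φ ≫ (τ.map a)⟦(1 : ℤ)⟧') f = η X Y φ (a ≫ f))

/-- `θ` is the Coxeter transformation of `D`: the endomorphism of the Grothendieck group of `D`
induced by the Auslander-Reiten translation. -/
def IsCoxeterTransformation (θ : AddMonoid.End (K0 D)) : Prop :=
  ∃ τ : D ⥤ D, IsAuslanderReitenTranslation k τ ∧ ∀ X : D, θ (K0.of X) = K0.of (τ.obj X)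

end AuslanderReiten

end TamariCoxeter

/-! The proof has a representation-theoretic half and a combinatorial half, joined by the formula `θ
[P_v] = -[I_v]`, where `P_v` and `I_v` are the indecomposable projective and injective modules at
`v`.

Homological half. `Hom(P_v, M)` is `M_v` and `Hom(M, I_v)` is the dual of `M_v`, and all Hom spaces
with a nonzero shift vanish, so `I_v` represents the dual of `Hom(P_v, -)` on the whole bounded
derived category (`isSerreDual_proj_inj`). Serre duals pass through distinguished triangles
(`isSerreDual_of_distTriang`), and the `P_v`, or the `I_v`, generate, so every object has a Serre
dual and is one. This gives `τ`, and its effect on classes respects triangles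
(`existsUnique_isCoxeterTransformation`). The class of a module depends linearly on its dimension
vector (`exists_class_hom`), and the dimension vectors of `P_v` and `I_v` are the indicator
functions of the up-set and the down-set of `v`.

Combinatorial half. Send a tree to the product, over its vertices, of `1 / (x r - x l)`, where `l`
and `r` are the extreme leaves above the vertex. By partial fractions, the sum over an up-set and
the sum over a down-set are again products of inverses of differences (`sum_above`, `sum_below`).
The up-set fractions are linearly independent (`codeFrac_linearIndependent`), so linear combinations
of trees embed in functions of `x 0, …, x n`. There `θ` becomes `upFrac t ↦ -downFrac t`. The key
computation (`downFrac_mem_coxGraph`) shows that it sends `downFrac t` to `(-1) ^ (n + 1)` times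
`upFrac t` with its variables rotated cyclically. Hence `θ ^ 2` is `(-1) ^ n` times a rotation of
order `n + 1`, and `θ ^ (2 * n + 2)` is the sign `(-1) ^ (n * (n + 1)) = 1`. -/

namespace TamariCoxeter

/-! ### Up-sets and down-sets of the Tamari order -/

/-- The trees obtained from `a ∧ b` by successive rotations along the path from the root to the
vertex that carries `b`. -/
def slideUp : BinaryTree Unit → BinaryTree Unit → List (BinaryTree Unit)
  | .nil, b => [.node () .nil b]
  | .node _ c r, b => .node () (.node () c r) b :: (slideUp r b).map (.node () c)

/-- The trees from which `a ∧ b` is obtained by successive rotations along the path from the root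
to the vertex that carries `a`. -/
def slideDown (a : BinaryTree Unit) : BinaryTree Unit → List (BinaryTree Unit)
  | .nil => [.node () a .nil]
  | .node _ l d => .node () a (.node () l d) :: (slideDown a l).map (fun w => .node () w d)

/-- The trees above a given tree in the Tamari order. -/
def above : BinaryTree Unit → List (BinaryTree Unit)
  | .nil => [.nil]
  | .node _ a b => ((above a).product (above b)).flatMap fun p => slideUp p.1 p.2

/-- The trees below a given tree in the Tamari order. -/
def below : BinaryTree Unit → List (BinaryTree Unit)
  | .nil => [.nil]
  | .node _ a b => ((below a).product (below b)).flatMap fun p => slideDown p.1 p.2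

theorem numNodes_of_mem_slideUp {a b w : BinaryTree Unit} (h : w ∈ slideUp a b) :
    w.numNodes = a.numNodes + b.numNodes + 1 := by
  induction a generalizing w with
  | nil => simp only [slideUp, List.mem_singleton] at h; subst h; simp [BinaryTree.numNodes]
  | node _ c r _ ih =>
    simp only [slideUp, List.mem_cons, List.mem_map] at h
    rcases h with rfl | ⟨w', h, rfl⟩
    · simp [BinaryTree.numNodes]
    · have := ih h
      simp only [BinaryTree.numNodes]; omega

theorem numNodes_of_mem_slideDown {a b w : BinaryTree Unit} (h : w ∈ slideDown a b) :
    w.numNodes = a.numNodes + b.numNodes + 1 := by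
  induction b generalizing w with
  | nil => simp only [slideDown, List.mem_singleton] at h; subst h; simp [BinaryTree.numNodes]
  | node _ l d ih _ =>
    simp only [slideDown, List.mem_cons, List.mem_map] at h
    rcases h with rfl | ⟨w', h, rfl⟩
    · simp [BinaryTree.numNodes]
    · have := ih h
      simp only [BinaryTree.numNodes]; omega

theorem node_mem_slideUp (a b : BinaryTree Unit) : .node () a b ∈ slideUp a b := by
  cases a <;> simp [slideUp]

theorem node_mem_slideDown (a b : BinaryTree Unit) : .node () a b ∈ slideDown a b := by
  cases b <;> simp [slideDown]

theorem reflTransGen_left {a a' : BinaryTree Unit} (b : BinaryTree Unit)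
    (h : Relation.ReflTransGen Rotation a a') :
    Relation.ReflTransGen Rotation (.node () a b) (.node () a' b) := by
  induction h with
  | refl => exact .refl
  | tail _ h ih => exact ih.tail (.left b h)

theorem reflTransGen_right (a : BinaryTree Unit) {b b' : BinaryTree Unit}
    (h : Relation.ReflTransGen Rotation b b') :
    Relation.ReflTransGen Rotation (.node () a b) (.node () a b') := by
  induction h with
  | refl => exact .refl
  | tail _ h ih => exact ih.tail (.right a h)

theorem reflTransGen_of_mem_slideUp {a b w : BinaryTree Unit} (h : w ∈ slideUp a b) :
    Relation.ReflTransGen Rotation (.node () a b) w := by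
  induction a generalizing w with
  | nil => simp only [slideUp, List.mem_singleton] at h; subst h; exact .refl
  | node _ c r _ ih =>
    simp only [slideUp, List.mem_cons, List.mem_map] at h
    rcases h with rfl | ⟨w', h, rfl⟩
    · exact .refl
    · exact .head (.rot c r b) (reflTransGen_right c (ih h))

theorem reflTransGen_of_mem_slideDown {a b w : BinaryTree Unit} (h : w ∈ slideDown a b) :
    Relation.ReflTransGen Rotation w (.node () a b) := by
  induction b generalizing w with
  | nil => simp only [slideDown, List.mem_singleton] at h; subst h; exact .refl
  | node _ l d ih _ =>
    simp only [slideDown, List.mem_cons, List.mem_map] at h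
    rcases h with rfl | ⟨w', h, rfl⟩
    · exact .refl
    · exact .tail (reflTransGen_left d (ih h)) (.rot a l d)

/-- A rotation of a tree in the list either involves the vertex carrying `b` and the one above it on
the path, and then moves one step further in the same list, or it is already visible as a rotation
of `a` or of `b`. This makes `above` closed under rotations. -/
theorem exists_slideUp_of_rotation {a b w w' : BinaryTree Unit} (h : w ∈ slideUp a b)
    (hw : Rotation w w') : ∃ a' b', (a = a' ∨ Rotation a a') ∧ (b = b' ∨ Rotation b b') ∧
      w' ∈ slideUp a' b' := by
  induction a generalizing w w' with
  | nil =>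
    simp only [slideUp, List.mem_singleton] at h; subst h
    cases hw with
    | left _ h => cases h
    | right _ h => exact ⟨_, _, .inl rfl, .inr h, node_mem_slideUp _ _⟩
  | node _ c r _ ih =>
    simp only [slideUp, List.mem_cons, List.mem_map] at h
    rcases h with rfl | ⟨w₁, h, rfl⟩
    · cases hw with
      | rot =>
        exact ⟨_, _, .inl rfl, .inl rfl, by simp [slideUp, node_mem_slideUp]⟩
      | left _ h => exact ⟨_, _, .inr h, .inl rfl, node_mem_slideUp _ _⟩
      | right _ h => exact ⟨_, _, .inl rfl, .inr h, node_mem_slideUp _ _⟩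
    · cases hw with
      | rot p q =>
        exact ⟨_, _, .inr (.rot p q r), .inl rfl, by simp [slideUp, h]⟩
      | left _ h' => exact ⟨_, _, .inr (.left r h'), .inl rfl, by simp [slideUp, h]⟩
      | right _ h' =>
        obtain ⟨r', b', hr, hb, hm⟩ := ih h h'
        refine ⟨.node () c r', b', ?_, hb, by simp [slideUp, hm]⟩
        rcases hr with rfl | hr
        · exact .inl rfl
        · exact .inr (.right c hr)

theorem exists_slideDown_of_rotation {a b w w' : BinaryTree Unit} (h : w ∈ slideDown a b)
    (hw : Rotation w' w) : ∃ a' b', (a = a' ∨ Rotation a' a) ∧ (b = b' ∨ Rotation b' b) ∧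
      w' ∈ slideDown a' b' := by
  induction b generalizing w w' with
  | nil =>
    simp only [slideDown, List.mem_singleton] at h; subst h
    cases hw with
    | right _ h => cases h
    | left _ h => exact ⟨_, _, .inr h, .inl rfl, node_mem_slideDown _ _⟩
  | node _ l d ih _ =>
    simp only [slideDown, List.mem_cons, List.mem_map] at h
    rcases h with rfl | ⟨w₁, h, rfl⟩
    · cases hw with
      | rot =>
        exact ⟨_, _, .inl rfl, .inl rfl, by simp [slideDown, node_mem_slideDown]⟩
      | left _ h => exact ⟨_, _, .inr h, .inl rfl, node_mem_slideDown _ _⟩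
      | right _ h => exact ⟨_, _, .inl rfl, .inr h, node_mem_slideDown _ _⟩
    · cases hw with
      | rot _ p q =>
        exact ⟨_, _, .inl rfl, .inr (.rot l p q), by simp [slideDown, h]⟩
      | right _ h' => exact ⟨_, _, .inl rfl, .inr (.right l h'), by simp [slideDown, h]⟩
      | left _ h' =>
        obtain ⟨a', l', ha, hl, hm⟩ := ih h h'
        refine ⟨a', .node () l' d, ha, ?_, by simp [slideDown, hm]⟩
        rcases hl with rfl | hl
        · exact .inl rfl
        · exact .inr (.left d hl)

theorem self_mem_above (t : BinaryTree Unit) : t ∈ above t := by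
  induction t with
  | nil => simp [above]
  | node _ a b iha ihb =>
    simp only [above, List.mem_flatMap]
    exact ⟨(a, b), List.mem_product.2 ⟨iha, ihb⟩, node_mem_slideUp a b⟩

theorem self_mem_below (t : BinaryTree Unit) : t ∈ below t := by
  induction t with
  | nil => simp [below]
  | node _ a b iha ihb =>
    simp only [below, List.mem_flatMap]
    exact ⟨(a, b), List.mem_product.2 ⟨iha, ihb⟩, node_mem_slideDown a b⟩

theorem mem_above_of_rotation {t w w' : BinaryTree Unit} (h : w ∈ above t) (hw : Rotation w w') :
    w' ∈ above t := by
  induction t generalizing w w' with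
  | nil => simp only [above, List.mem_singleton] at h; subst h; cases hw
  | node _ a b iha ihb =>
    simp only [above, List.mem_flatMap, Prod.exists, List.pair_mem_product] at h ⊢
    obtain ⟨a', b', ⟨ha, hb⟩, h⟩ := h
    obtain ⟨a'', b'', ha', hb', h⟩ := exists_slideUp_of_rotation h hw
    refine ⟨a'', b'', ⟨?_, ?_⟩, h⟩
    · rcases ha' with rfl | ha'
      exacts [ha, iha ha ha']
    · rcases hb' with rfl | hb'
      exacts [hb, ihb hb hb']

theorem mem_below_of_rotation {t w w' : BinaryTree Unit} (h : w ∈ below t) (hw : Rotation w' w) :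
    w' ∈ below t := by
  induction t generalizing w w' with
  | nil => simp only [below, List.mem_singleton] at h; subst h; cases hw
  | node _ a b iha ihb =>
    simp only [below, List.mem_flatMap, Prod.exists, List.pair_mem_product] at h ⊢
    obtain ⟨a', b', ⟨ha, hb⟩, h⟩ := h
    obtain ⟨a'', b'', ha', hb', h⟩ := exists_slideDown_of_rotation h hw
    refine ⟨a'', b'', ⟨?_, ?_⟩, h⟩
    · rcases ha' with rfl | ha'
      exacts [ha, iha ha ha']
    · rcases hb' with rfl | hb'
      exacts [hb, ihb hb hb']

/-- Everything above `a ∧ b` is reached by moving `a` and `b` upwards separately and then sliding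
along the path; the list so obtained contains the tree and is closed under rotations. -/
theorem mem_above_iff {t w : BinaryTree Unit} :
    w ∈ above t ↔ Relation.ReflTransGen Rotation t w := by
  constructor
  · intro h
    induction t generalizing w with
    | nil => simp only [above, List.mem_singleton] at h; subst h; exact .refl
    | node _ a b iha ihb =>
      simp only [above, List.mem_flatMap, Prod.exists, List.pair_mem_product] at h
      obtain ⟨a', b', ⟨ha, hb⟩, h⟩ := h
      exact ((reflTransGen_left b (iha ha)).trans (reflTransGen_right a' (ihb hb))).trans
        (reflTransGen_of_mem_slideUp h)
  · intro h
    induction h with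
    | refl => exact self_mem_above t
    | tail _ h ih => exact mem_above_of_rotation ih h

theorem mem_below_iff {t w : BinaryTree Unit} :
    w ∈ below t ↔ Relation.ReflTransGen Rotation w t := by
  constructor
  · intro h
    induction t generalizing w with
    | nil => simp only [below, List.mem_singleton] at h; subst h; exact .refl
    | node _ a b iha ihb =>
      simp only [below, List.mem_flatMap, Prod.exists, List.pair_mem_product] at h
      obtain ⟨a', b', ⟨ha, hb⟩, h⟩ := h
      exact (reflTransGen_of_mem_slideDown h).trans
        ((reflTransGen_left b' (iha ha)).trans (reflTransGen_right a (ihb hb)))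
  · intro h
    induction h using Relation.ReflTransGen.head_induction_on with
    | refl => exact self_mem_below t
    | head h _ ih => exact mem_below_of_rotation ih h

theorem numNodes_of_reflTransGen {s t : BinaryTree Unit} (h : Relation.ReflTransGen Rotation s t) :
    s.numNodes = t.numNodes := by
  induction h with
  | refl => rfl
  | tail _ h ih => exact ih.trans h.numNodes_eq

theorem numNodes_of_mem_above {t w : BinaryTree Unit} (h : w ∈ above t) :
    w.numNodes = t.numNodes :=
  (numNodes_of_reflTransGen (mem_above_iff.1 h)).symm

theorem numNodes_of_mem_below {t w : BinaryTree Unit} (h : w ∈ below t) :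
    w.numNodes = t.numNodes :=
  numNodes_of_reflTransGen (mem_below_iff.1 h)

/-! ### Each tree is listed only once. -/

theorem slideUp_nodup (a b : BinaryTree Unit) : (slideUp a b).Nodup := by
  induction a with
  | nil => simp [slideUp]
  | node _ c r _ ih =>
    rw [slideUp, List.nodup_cons]
    refine ⟨?_, ih.map fun _ _ h => by simpa using h⟩
    simp only [List.mem_map, not_exists, not_and]
    intro w _ h
    have := congrArg (fun t => match t with | .nil => 0 | .node _ a _ => a.numNodes) h
    simp only [BinaryTree.numNodes] at this
    omega

theorem slideDown_nodup (a b : BinaryTree Unit) : (slideDown a b).Nodup := by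
  induction b with
  | nil => simp [slideDown]
  | node _ l d ih _ =>
    rw [slideDown, List.nodup_cons]
    refine ⟨?_, ih.map fun _ _ h => by simpa using h⟩
    simp only [List.mem_map, not_exists, not_and]
    intro w _ h
    have := congrArg (fun t => match t with | .nil => 0 | .node _ _ b => b.numNodes) h
    simp only [BinaryTree.numNodes] at this
    omega

/-- In `w`, the tree `b` is the right subtree of a vertex on the rightmost branch. Sizes of right
subtrees strictly decrease along this branch, so the size of `b` locates that vertex and `a` is
recovered by undoing the slide. -/
theorem slideUp_injective {a b a' b' w : BinaryTree Unit} (hb : b.numNodes = b'.numNodes)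
    (h : w ∈ slideUp a b) (h' : w ∈ slideUp a' b') : a = a' ∧ b = b' := by
  induction a generalizing a' w with
  | nil =>
    simp only [slideUp, List.mem_singleton] at h; subst h
    cases a' with
    | nil => simpa [slideUp] using h'
    | node _ c' r' =>
      simp only [slideUp, List.mem_cons, List.mem_map, BinaryTree.node.injEq] at h'
      rcases h' with h' | ⟨w', h', h''⟩
      · exact ⟨h'.2.1, h'.2.2⟩
      · have := numNodes_of_mem_slideUp h'
        rw [h''.2.2] at this
        omega
  | node _ c r _ ih =>
    simp only [slideUp, List.mem_cons, List.mem_map] at h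
    cases a' with
    | nil =>
      simp only [slideUp, List.mem_singleton] at h'; subst h'
      simp only [BinaryTree.node.injEq] at h
      rcases h with h | ⟨w', h, h''⟩
      · exact ⟨h.2.1.symm, h.2.2.symm⟩
      · have := numNodes_of_mem_slideUp h
        rw [h''.2.2] at this
        omega
    | node _ c' r' =>
      simp only [slideUp, List.mem_cons, List.mem_map] at h'
      rcases h with rfl | ⟨w₁, h, rfl⟩
      · rcases h' with h' | ⟨w₂, h', h''⟩
        · simpa using h'
        · have := numNodes_of_mem_slideUp h'
          simp only [BinaryTree.node.injEq] at h''
          rw [h''.2.2] at this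
          omega
      · rcases h' with h' | ⟨w₂, h', h''⟩
        · have := numNodes_of_mem_slideUp h
          simp only [BinaryTree.node.injEq] at h'
          rw [h'.2.2] at this
          omega
        · simp only [BinaryTree.node.injEq] at h''
          obtain ⟨_, rfl, rfl⟩ := h''
          obtain ⟨rfl, rfl⟩ := ih h h'
          exact ⟨rfl, rfl⟩

theorem slideDown_injective {a b a' b' w : BinaryTree Unit} (ha : a.numNodes = a'.numNodes)
    (h : w ∈ slideDown a b) (h' : w ∈ slideDown a' b') : a = a' ∧ b = b' := by
  induction b generalizing b' w with
  | nil =>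
    simp only [slideDown, List.mem_singleton] at h; subst h
    cases b' with
    | nil => simpa [slideDown] using h'
    | node _ c' r' =>
      simp only [slideDown, List.mem_cons, List.mem_map, BinaryTree.node.injEq] at h'
      rcases h' with h' | ⟨w', h', h''⟩
      · exact ⟨h'.2.1, h'.2.2⟩
      · have := numNodes_of_mem_slideDown h'
        rw [h''.2.1] at this
        omega
  | node _ l d ih _ =>
    simp only [slideDown, List.mem_cons, List.mem_map] at h
    cases b' with
    | nil =>
      simp only [slideDown, List.mem_singleton] at h'; subst h'
      simp only [BinaryTree.node.injEq] at h
      rcases h with h | ⟨w', h, h''⟩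
      · exact ⟨h.2.1.symm, h.2.2.symm⟩
      · have := numNodes_of_mem_slideDown h
        rw [h''.2.1] at this
        omega
    | node _ l' d' =>
      simp only [slideDown, List.mem_cons, List.mem_map] at h'
      rcases h with rfl | ⟨w₁, h, rfl⟩
      · rcases h' with h' | ⟨w₂, h', h''⟩
        · simpa using h'
        · have := numNodes_of_mem_slideDown h'
          simp only [BinaryTree.node.injEq] at h''
          rw [h''.2.1] at this
          omega
      · rcases h' with h' | ⟨w₂, h', h''⟩
        · have := numNodes_of_mem_slideDown h
          simp only [BinaryTree.node.injEq] at h'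
          rw [h'.2.1] at this
          omega
        · simp only [BinaryTree.node.injEq] at h''
          obtain ⟨_, rfl, rfl⟩ := h''
          obtain ⟨rfl, rfl⟩ := ih h h'
          exact ⟨rfl, rfl⟩

theorem above_nodup (t : BinaryTree Unit) : (above t).Nodup := by
  induction t with
  | nil => simp [above]
  | node _ a b iha ihb =>
    rw [above, List.nodup_flatMap]
    refine ⟨fun p _ => slideUp_nodup _ _, (iha.product ihb).imp_of_mem ?_⟩
    rintro ⟨a₁, b₁⟩ ⟨a₂, b₂⟩ h₁ h₂ hne
    replace h₁ := List.pair_mem_product.1 h₁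
    replace h₂ := List.pair_mem_product.1 h₂
    refine List.disjoint_left.2 fun w hw₁ hw₂ => hne ?_
    obtain ⟨rfl, rfl⟩ := slideUp_injective
      ((numNodes_of_mem_above h₁.2).trans (numNodes_of_mem_above h₂.2).symm) hw₁ hw₂
    rfl

theorem below_nodup (t : BinaryTree Unit) : (below t).Nodup := by
  induction t with
  | nil => simp [below]
  | node _ a b iha ihb =>
    rw [below, List.nodup_flatMap]
    refine ⟨fun p _ => slideDown_nodup _ _, (iha.product ihb).imp_of_mem ?_⟩
    rintro ⟨a₁, b₁⟩ ⟨a₂, b₂⟩ h₁ h₂ hne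
    replace h₁ := List.pair_mem_product.1 h₁
    replace h₂ := List.pair_mem_product.1 h₂
    refine List.disjoint_left.2 fun w hw₁ hw₂ => hne ?_
    obtain ⟨rfl, rfl⟩ := slideDown_injective
      ((numNodes_of_mem_below h₁.1).trans (numNodes_of_mem_below h₂.1).symm) hw₁ hw₂
    rfl

/-! ### Rational functions attached to trees -/

/-- Functions of sequences of pairwise distinct real numbers. -/
abbrev SeqFun : Type := (ℕ ↪ ℝ) → ℝ

/-- The sequence `x` without its first `m` terms. -/
abbrev dropSeq (m : ℕ) (x : ℕ ↪ ℝ) : ℕ ↪ ℝ := (addRightEmbedding m).trans x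

@[simp] theorem dropSeq_apply (m : ℕ) (x : ℕ ↪ ℝ) (j : ℕ) : dropSeq m x j = x (j + m) := rfl

/-- The fraction of a tree: the product over all vertices of the inverse of `x r - x l`, where
`l, …, r` are the leaves above the vertex. -/
noncomputable def treeFrac : BinaryTree Unit → SeqFun
  | .nil, _ => 1
  | .node _ a b, x => treeFrac a x * treeFrac b (dropSeq (a.numNodes + 1) x) *
      (x (a.numNodes + 1 + b.numNodes) - x 0)⁻¹

/-- The fraction of the up-set of a tree. -/
noncomputable def upFrac : BinaryTree Unit → SeqFun
  | .nil, _ => 1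
  | .node _ a b, x => upFrac a x * upFrac b (dropSeq (a.numNodes + 1) x) *
      (x (a.numNodes + 1 + b.numNodes) - x a.numNodes)⁻¹

/-- The fraction of the down-set of a tree. -/
noncomputable def downFrac : BinaryTree Unit → SeqFun
  | .nil, _ => 1
  | .node _ a b, x => downFrac a x * downFrac b (dropSeq (a.numNodes + 1) x) *
      (x (a.numNodes + 1) - x 0)⁻¹

theorem sub_ne_zero_of_lt (x : ℕ ↪ ℝ) {i j : ℕ} (h : i < j) : x j - x i ≠ 0 :=
  sub_ne_zero.2 fun e => h.ne' (x.injective e)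

/-- For `a = c ∧ r`, put `u = x a.numNodes` and let `v` be the last variable. The head of the list
and the inductive value of its tail share a factor `1 / (v - x 0)`, and the sum closes up by `1 / (u
- x 0) + 1 / (v - u) = (v - x 0) / ((u - x 0) * (v - u))`. -/
theorem sum_slideUp (a b : BinaryTree Unit) (x : ℕ ↪ ℝ) :
    ((slideUp a b).map (treeFrac · x)).sum = treeFrac a x *
      treeFrac b (dropSeq (a.numNodes + 1) x) *
        (x (a.numNodes + 1 + b.numNodes) - x a.numNodes)⁻¹ := by
  induction a generalizing x with
  | nil => simp [slideUp, treeFrac, BinaryTree.numNodes]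
  | node _ c r _ ih =>
    have h₁ : ((slideUp r b).map (fun w => treeFrac (.node () c w) x)).sum =
        treeFrac c x * ((slideUp r b).map (treeFrac · (dropSeq (c.numNodes + 1) x))).sum *
          (x (c.numNodes + 1 + (r.numNodes + b.numNodes + 1)) - x 0)⁻¹ := by
      rw [← List.sum_map_mul_left, ← List.sum_map_mul_right]
      refine congrArg _ (List.map_congr_left fun w hw => ?_)
      rw [treeFrac, numNodes_of_mem_slideUp hw]
    rw [slideUp, List.map_cons, List.sum_cons, List.map_map, Function.comp_def, h₁, ih]
    simp only [treeFrac, BinaryTree.numNodes, dropSeq_apply]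
    rw [show dropSeq (r.numNodes + 1) (dropSeq (c.numNodes + 1) x) =
      dropSeq (c.numNodes + r.numNodes + 1 + 1) x from by
        ext j; simp only [dropSeq_apply]; congr 1; omega]
    rw [show c.numNodes + 1 + (r.numNodes + b.numNodes + 1) =
        c.numNodes + r.numNodes + 1 + 1 + b.numNodes by omega,
      show c.numNodes + 1 + r.numNodes = c.numNodes + r.numNodes + 1 by omega,
      show r.numNodes + 1 + b.numNodes + (c.numNodes + 1) =
        c.numNodes + r.numNodes + 1 + 1 + b.numNodes by omega,
      show r.numNodes + (c.numNodes + 1) = c.numNodes + r.numNodes + 1 by omega]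
    have h₁ := sub_ne_zero_of_lt x (show 0 < c.numNodes + r.numNodes + 1 by omega)
    have h₂ := sub_ne_zero_of_lt x (show 0 < c.numNodes + r.numNodes + 1 + 1 + b.numNodes by omega)
    have h₃ := sub_ne_zero_of_lt x
      (show c.numNodes + r.numNodes + 1 < c.numNodes + r.numNodes + 1 + 1 + b.numNodes by omega)
    field_simp
    ring

theorem sum_slideDown (a b : BinaryTree Unit) (x : ℕ ↪ ℝ) :
    ((slideDown a b).map (treeFrac · x)).sum = treeFrac a x *
      treeFrac b (dropSeq (a.numNodes + 1) x) * (x (a.numNodes + 1) - x 0)⁻¹ := by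
  induction b generalizing x with
  | nil => simp [slideDown, treeFrac, BinaryTree.numNodes]
  | node _ l d ih _ =>
    have h₁ : ((slideDown a l).map (fun w => treeFrac (.node () w d) x)).sum =
        ((slideDown a l).map (treeFrac · x)).sum *
          treeFrac d (dropSeq (a.numNodes + l.numNodes + 1 + 1) x) *
          (x (a.numNodes + l.numNodes + 1 + 1 + d.numNodes) - x 0)⁻¹ := by
      rw [← List.sum_map_mul_right, ← List.sum_map_mul_right]
      refine congrArg _ (List.map_congr_left fun w hw => ?_)
      rw [treeFrac, numNodes_of_mem_slideDown hw]
    rw [slideDown, List.map_cons, List.sum_cons, List.map_map, Function.comp_def, h₁, ih]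
    simp only [treeFrac, BinaryTree.numNodes, dropSeq_apply]
    rw [show dropSeq (l.numNodes + 1) (dropSeq (a.numNodes + 1) x) =
      dropSeq (a.numNodes + l.numNodes + 1 + 1) x from by
        ext j; simp only [dropSeq_apply]; congr 1; omega]
    rw [show a.numNodes + 1 + (l.numNodes + d.numNodes + 1) =
        a.numNodes + l.numNodes + 1 + 1 + d.numNodes by omega,
      show l.numNodes + 1 + d.numNodes + (a.numNodes + 1) =
        a.numNodes + l.numNodes + 1 + 1 + d.numNodes by omega, zero_add]
    have h₁ := sub_ne_zero_of_lt x (show 0 < a.numNodes + 1 by omega)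
    have h₂ := sub_ne_zero_of_lt x (show 0 < a.numNodes + l.numNodes + 1 + 1 + d.numNodes by omega)
    have h₃ := sub_ne_zero_of_lt x
      (show a.numNodes + 1 < a.numNodes + l.numNodes + 1 + 1 + d.numNodes by omega)
    field_simp
    ring

theorem sum_map_product {α β : Type*} (l : List α) (m : List β) (f : α → ℝ) (g : β → ℝ) :
    ((l.product m).map fun p => f p.1 * g p.2).sum = (l.map f).sum * (m.map g).sum := by
  induction l with
  | nil => simp [List.product]
  | cons a l ih =>
    rw [List.product, List.flatMap_cons, ← List.product, List.map_append, List.sum_append, ih,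
      List.map_cons, List.sum_cons, add_mul, List.map_map, Function.comp_def]
    congr 1
    exact List.sum_map_mul_left (r := f a) (f := g) (l := m)

theorem sum_map_flatMap {α β : Type*} (l : List α) (f : α → List β) (g : β → ℝ) :
    ((l.flatMap f).map g).sum = (l.map fun a => ((f a).map g).sum).sum := by
  induction l with
  | nil => rfl
  | cons a l ih => rw [List.flatMap_cons, List.map_append, List.sum_append, ih, List.map_cons,
      List.sum_cons]

/-- The factor produced by a slide depends only on the sizes of the two trees, and sizes are
constant on up-sets, so the sum over pairs splits as a product. -/
theorem sum_above (t : BinaryTree Unit) (x : ℕ ↪ ℝ) :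
    ((above t).map (treeFrac · x)).sum = upFrac t x := by
  induction t generalizing x with
  | nil => simp [above, treeFrac, upFrac]
  | node _ a b iha ihb =>
    rw [above, sum_map_flatMap, upFrac, ← iha, ← ihb, ← sum_map_product,
      ← List.sum_map_mul_right]
    refine congrArg _ (List.map_congr_left fun p hp => ?_)
    have hp := List.pair_mem_product.1 hp
    rw [sum_slideUp, numNodes_of_mem_above hp.1, numNodes_of_mem_above hp.2]

theorem sum_below (t : BinaryTree Unit) (x : ℕ ↪ ℝ) :
    ((below t).map (treeFrac · x)).sum = downFrac t x := by
  induction t generalizing x with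
  | nil => simp [below, treeFrac, downFrac]
  | node _ a b iha ihb =>
    rw [below, sum_map_flatMap, downFrac, ← iha, ← ihb, ← sum_map_product,
      ← List.sum_map_mul_right]
    refine congrArg _ (List.map_congr_left fun p hp => ?_)
    have hp := List.pair_mem_product.1 hp
    rw [sum_slideDown, numNodes_of_mem_below hp.1]

/-! ### Linear independence of the fractions of up-sets -/

/-- The fraction attached to a list `c₀, c₁, …`: the product of the inverses of
`x (k + 1 + cₖ) - x k`. -/
noncomputable def codeFrac : List ℕ → SeqFun
  | [], _ => 1
  | c :: cs, x => codeFrac cs (dropSeq 1 x) * (x (c + 1) - x 0)⁻¹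

/-- The list of the sizes of the right subtrees of the vertices of a tree, in symmetric order. -/
def code : BinaryTree Unit → List ℕ
  | .nil => []
  | .node _ a b => code a ++ b.numNodes :: code b

theorem length_code (t : BinaryTree Unit) : (code t).length = t.numNodes := by
  induction t with
  | nil => rfl
  | node _ a b iha ihb => simp only [code, List.length_append, List.length_cons, iha, ihb,
      BinaryTree.numNodes]; omega

/-- In symmetric order, the right subtree of the vertex `k` occupies exactly the vertices following
`k`, as many as its size. -/
theorem getElem_code_lt (t : BinaryTree Unit) (k : ℕ) (hk : k < (code t).length) :
    (code t)[k] + k < t.numNodes := by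
  induction t generalizing k with
  | nil => simp [code] at hk
  | node _ a b iha ihb =>
    simp only [code, BinaryTree.numNodes, List.getElem_append, length_code] at hk ⊢
    split_ifs with h
    · have := iha k (by rwa [length_code])
      omega
    · obtain ⟨j, rfl⟩ := Nat.exists_eq_add_of_le (not_lt.1 h)
      simp only [Nat.add_sub_cancel_left]
      rcases j with _ | j
      · simp only [List.getElem_cons_zero]; omega
      · simp only [List.length_append, List.length_cons, length_code] at hk
        have := ihb j (by rw [length_code]; omega)
        simp only [List.getElem_cons_succ]; omega

/-- The root is the first vertex whose right subtree reaches the last vertex: right subtrees inside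
the left subtree of the root end before the root. So the code determines the position of the root.
-/
theorem numNodes_le_of_code_eq {a b a' b' : BinaryTree Unit}
    (h : code (.node () a b) = code (.node () a' b')) : a'.numNodes ≤ a.numNodes := by
  by_contra! hlt
  have hl := congrArg List.length h
  simp only [length_code, BinaryTree.numNodes] at hl
  have h₁ := getElem_code_lt a' a.numNodes (by rwa [length_code])
  have h₂ : (code (.node () a b))[a.numNodes]'(by
      simp only [length_code, BinaryTree.numNodes]; omega) = b.numNodes := by
    simp [code, length_code]
  have h₃ : (code (.node () a' b'))[a.numNodes]'(by
      simp only [length_code, BinaryTree.numNodes]; omega) =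
        (code a')[a.numNodes]'(by rwa [length_code]) := by
    simp [code, length_code, hlt]
  simp only [h] at h₂
  omega

theorem code_injective : Function.Injective code := by
  intro s t h
  induction s generalizing t with
  | nil =>
    cases t with
    | nil => rfl
    | node => simp [code] at h
  | node _ a b iha ihb =>
    cases t with
    | nil => simp [code] at h
    | node _ a' b' =>
      have ha := le_antisymm (numNodes_le_of_code_eq h.symm) (numNodes_le_of_code_eq h)
      simp only [code] at h
      obtain ⟨h₁, h₂⟩ := List.append_inj h (by rw [length_code, length_code, ha])
      rw [iha h₁, ihb (List.cons.inj h₂).2]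

theorem codeFrac_append (l m : List ℕ) (x : ℕ ↪ ℝ) :
    codeFrac (l ++ m) x = codeFrac l x * codeFrac m (dropSeq l.length x) := by
  induction l generalizing x with
  | nil => rw [List.nil_append, codeFrac, one_mul]; rfl
  | cons c l ih =>
    rw [List.cons_append, codeFrac, codeFrac, ih, List.length_cons]
    rw [show dropSeq l.length (dropSeq 1 x) = dropSeq (l.length + 1) x from rfl]
    ring

theorem upFrac_eq_codeFrac (t : BinaryTree Unit) (x : ℕ ↪ ℝ) :
    upFrac t x = codeFrac (code t) x := by
  induction t generalizing x with
  | nil => rfl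
  | node _ a b iha ihb =>
    rw [code, codeFrac_append, codeFrac, upFrac, iha, ihb, length_code]
    simp only [dropSeq_apply]
    rw [show dropSeq 1 (dropSeq a.numNodes x) = dropSeq (a.numNodes + 1) x from by
        ext j; simp only [dropSeq_apply]; congr 1; omega,
      show b.numNodes + 1 + a.numNodes = a.numNodes + 1 + b.numNodes by omega, zero_add, mul_assoc]

/-- Independence of simple fractions with distinct poles. After clearing denominators there is a
polynomial in `z` that vanishes off a countable set, hence everywhere; its value at the pole `y c`
isolates `A c`. -/
theorem eq_zero_of_sum_div_eq_zero (s : Finset ℕ) (A : ℕ → ℝ) (y : ℕ ↪ ℝ)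
    (h : ∀ z ∉ Set.range y, ∑ c ∈ s, A c * (y c - z)⁻¹ = 0) : ∀ c ∈ s, A c = 0 := by
  classical
  intro c hc
  let p : Polynomial ℝ := ∑ c ∈ s, Polynomial.C (A c) *
    ∏ d ∈ s.erase c, (Polynomial.C (y d) - Polynomial.X)
  have hp : p = 0 := by
    refine Polynomial.eq_zero_of_infinite_isRoot p (Set.Infinite.mono (s := (Set.range y)ᶜ) ?_ ?_)
    · intro z hz
      have hne : ∀ d, y d - z ≠ 0 := fun d e => hz ⟨d, sub_eq_zero.1 e⟩
      have : p.eval z = (∏ d ∈ s, (y d - z)) * ∑ c ∈ s, A c * (y c - z)⁻¹ := by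
        simp only [p, Polynomial.eval_finsetSum, Polynomial.eval_mul, Polynomial.eval_C,
          Polynomial.eval_prod, Polynomial.eval_sub, Polynomial.eval_X, Finset.mul_sum]
        refine Finset.sum_congr rfl fun c hc => ?_
        rw [← Finset.mul_prod_erase s _ hc]
        field_simp [hne c]
      rw [Set.mem_ofPred_eq, Polynomial.IsRoot, this, h z hz, mul_zero]
    · intro hfin
      have : (Set.univ : Set ℝ).Countable := by
        rw [← Set.union_compl_self (Set.range y)]
        exact (Set.countable_range y).union hfin.countable
      exact Cardinal.not_countable_real this
  have h₀ : p.eval (y c) = A c * ∏ d ∈ s.erase c, (y d - y c) := by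
    simp only [p, Polynomial.eval_finsetSum, Polynomial.eval_mul, Polynomial.eval_C,
      Polynomial.eval_prod, Polynomial.eval_sub, Polynomial.eval_X]
    refine Finset.sum_eq_single_of_mem c hc fun d _ hd => ?_
    rw [Finset.prod_eq_zero (Finset.mem_erase.2 ⟨hd.symm, hc⟩) (sub_self _), mul_zero]
  rw [hp, Polynomial.eval_zero, eq_comm, mul_eq_zero] at h₀
  refine h₀.resolve_right (Finset.prod_ne_zero_iff.2 fun d hd => ?_)
  exact sub_ne_zero.2 fun e => (Finset.mem_erase.1 hd).1 (y.injective e)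

/-- The sequence `z, y 0, y 1, …`. -/
def consSeq (z : ℝ) (y : ℕ ↪ ℝ) (hz : z ∉ Set.range y) : ℕ ↪ ℝ where
  toFun := fun | 0 => z | j + 1 => y j
  inj' := by
    rintro (_ | i) (_ | j) h
    · rfl
    · exact (hz ⟨j, h.symm⟩).elim
    · exact (hz ⟨i, h⟩).elim
    · exact congrArg _ (y.injective h)

/-- Only the factor of the head `c` involves `x 0`, and as a function of `x 0` it has its pole at `x
(c + 1)`. Different heads give different poles, so the relation splits according to the head, and
the tails are handled by induction. -/
theorem codeFrac_linearIndependent (n : ℕ) (s : Finset (List ℕ)) (a : List ℕ → ℝ)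
    (hs : ∀ l ∈ s, l.length = n) (h : ∀ x, ∑ l ∈ s, a l * codeFrac l x = 0) :
    ∀ l ∈ s, a l = 0 := by
  classical
  induction n generalizing s a with
  | zero =>
    intro l hl
    have hs' : s = {[]} := by
      ext m
      rw [Finset.mem_singleton]
      refine ⟨fun hm => List.length_eq_zero_iff.1 (hs m hm), ?_⟩
      rintro rfl
      rwa [← List.length_eq_zero_iff.1 (hs l hl)]
    subst hs'
    obtain rfl := Finset.mem_singleton.1 hl
    simpa [codeFrac] using h ⟨fun j => j, Nat.cast_injective⟩
  | succ n ih =>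
    let hd : List ℕ → ℕ := fun l => l.headD 0
    have hcons : ∀ l ∈ s, l = hd l :: l.tail := by
      intro l hl
      cases l with
      | nil => exact absurd (hs _ hl) (by simp)
      | cons c l => rfl
    have hA : ∀ y : ℕ ↪ ℝ, ∀ c ∈ s.image hd,
        ∑ l ∈ s with hd l = c, a l * codeFrac l.tail y = 0 := by
      intro y
      refine eq_zero_of_sum_div_eq_zero (s.image hd) _ y fun z hz => ?_
      rw [← h (consSeq z y hz), ← Finset.sum_fiberwise_of_maps_to
        (g := hd) (t := s.image hd) (fun l hl => Finset.mem_image_of_mem _ hl)]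
      refine Finset.sum_congr rfl fun c _ => ?_
      rw [Finset.sum_mul]
      refine Finset.sum_congr rfl fun l hl => ?_
      rw [Finset.mem_filter] at hl
      conv_rhs => rw [hcons l hl.1, codeFrac, ← hcons l hl.1]
      rw [hl.2, mul_assoc]
      rfl
    intro l hl
    have key := ih ((s.filter (hd · = hd l)).image List.tail) (fun m => a (hd l :: m)) ?_ ?_
      l.tail (Finset.mem_image_of_mem _ (Finset.mem_filter.2 ⟨hl, rfl⟩))
    · rwa [hcons l hl]
    · intro m hm
      obtain ⟨l', hl', rfl⟩ := Finset.mem_image.1 hm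
      rw [List.length_tail, hs l' (Finset.mem_filter.1 hl').1, Nat.add_sub_cancel]
    · intro y
      rw [← hA y (hd l) (Finset.mem_image_of_mem _ hl), Finset.sum_image]
      · refine Finset.sum_congr rfl fun m hm => ?_
        rw [Finset.mem_filter] at hm
        rw [← hm.2, ← hcons m hm.1]
      · intro m hm m' hm' e
        rw [Finset.mem_coe, Finset.mem_filter] at hm hm'
        rw [hcons m hm.1, hcons m' hm'.1, hm.2, hm'.2, e]

/-! ### The graph of the Coxeter transformation on fractions -/

/-- The sequence `x 0, x (m + 1), x (m + 2), …`. -/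
def skipSeq (m : ℕ) (x : ℕ ↪ ℝ) : ℕ ↪ ℝ where
  toFun j := x (if j = 0 then 0 else j + m)
  inj' i j h := by
    have := x.injective h
    split_ifs at this <;> omega

/-- The sequence `x i, x 1, …, x (i - 1), x 0, x (i + 1), …`. -/
def swapSeq (i : ℕ) (x : ℕ ↪ ℝ) : ℕ ↪ ℝ := (Equiv.swap 0 i).toEmbedding.trans x

/-- The map `j ↦ j + 1` modulo `n + 1` on `0, …, n`, which fixes the numbers above `n`. -/
def rotIndex (n j : ℕ) : ℕ := if j < n then j + 1 else if j = n then 0 else j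

/-- The sequence `x 1, …, x n, x 0, x (n + 1), …`. -/
def rotSeq (n : ℕ) (x : ℕ ↪ ℝ) : ℕ ↪ ℝ where
  toFun j := x (rotIndex n j)
  inj' i j h := by
    have := x.injective h
    unfold rotIndex at this
    split_ifs at this <;> omega

theorem skipSeq_zero (m : ℕ) (x : ℕ ↪ ℝ) : skipSeq m x 0 = x 0 := rfl

theorem skipSeq_of_ne (m : ℕ) (x : ℕ ↪ ℝ) {j : ℕ} (h : j ≠ 0) : skipSeq m x j = x (j + m) :=
  congrArg x (if_neg h)

theorem swapSeq_zero (i : ℕ) (x : ℕ ↪ ℝ) : swapSeq i x 0 = x i :=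
  congrArg x (Equiv.swap_apply_left 0 i)

theorem swapSeq_of_ne {i j : ℕ} (x : ℕ ↪ ℝ) (h₀ : j ≠ 0) (h : j ≠ i) : swapSeq i x j = x j :=
  congrArg x (Equiv.swap_apply_of_ne_of_ne h₀ h)

theorem rotSeq_of_lt {n j : ℕ} (x : ℕ ↪ ℝ) (h : j < n) : rotSeq n x j = x (j + 1) :=
  congrArg x (if_pos h)

theorem rotSeq_self (n : ℕ) (x : ℕ ↪ ℝ) : rotSeq n x n = x 0 := by
  refine congrArg x ?_
  simp [rotIndex]

theorem upFrac_congr (t : BinaryTree Unit) {x y : ℕ ↪ ℝ} (h : ∀ j ≤ t.numNodes, x j = y j) :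
    upFrac t x = upFrac t y := by
  induction t generalizing x y with
  | nil => rfl
  | node _ a b iha ihb =>
    simp only [BinaryTree.numNodes] at h
    rw [upFrac, upFrac, iha fun j hj => h j (by omega),
      ihb (x := dropSeq _ x) (y := dropSeq _ y) fun j hj => h (j + (a.numNodes + 1)) (by omega),
      h _ (show a.numNodes + 1 + b.numNodes ≤ _ by omega), h a.numNodes (by omega)]

theorem downFrac_congr (t : BinaryTree Unit) {x y : ℕ ↪ ℝ} (h : ∀ j ≤ t.numNodes, x j = y j) :
    downFrac t x = downFrac t y := by
  induction t generalizing x y with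
  | nil => rfl
  | node _ a b iha ihb =>
    simp only [BinaryTree.numNodes] at h
    rw [downFrac, downFrac, iha fun j hj => h j (by omega),
      ihb (x := dropSeq _ x) (y := dropSeq _ y) fun j hj => h (j + (a.numNodes + 1)) (by omega),
      h (a.numNodes + 1) (by omega), h 0 (by omega)]

/-- The graph of the additive map that sends the fraction of an up-set to the opposite of the
fraction of the down-set. -/
def coxGraph (n : ℕ) : AddSubgroup (SeqFun × SeqFun) :=
  AddSubgroup.closure {p | ∃ t : BinaryTree Unit, t.numNodes = n ∧
    p = (upFrac t, fun x => -downFrac t x)}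

theorem mem_coxGraph (t : BinaryTree Unit) :
    (upFrac t, fun x => -downFrac t x) ∈ coxGraph t.numNodes :=
  AddSubgroup.subset_closure ⟨t, rfl, rfl⟩

theorem one_mem_coxGraph : ((fun _ => 1, fun _ => -1) : SeqFun × SeqFun) ∈ coxGraph 0 :=
  mem_coxGraph .nil

theorem coxGraph_congr {n n' : ℕ} {f f' g g' : SeqFun} (h : (f, f') ∈ coxGraph n) (hn : n' = n)
    (e : ∀ x, g x = f x) (e' : ∀ x, g' x = f' x) : (g, g') ∈ coxGraph n' := by
  rw [hn, funext e, funext e']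
  exact h

/-- Additive maps between pairs of functions given by multiplication and substitution. -/
def coxMul (α β : (ℕ ↪ ℝ) → (ℕ ↪ ℝ)) (γ : SeqFun) : SeqFun →+ SeqFun →+ SeqFun where
  toFun f :=
    { toFun := fun g x => f (α x) * g (β x) * γ x
      map_zero' := by ext; simp
      map_add' := by intros; ext; simp only [Pi.add_apply]; ring }
  map_zero' := by ext; simp
  map_add' := by intros; ext; simp only [Pi.add_apply, AddMonoidHom.coe_mk, ZeroHom.coe_mk,
    AddMonoidHom.add_apply]; ring

@[simp] theorem coxMul_apply (α β : (ℕ ↪ ℝ) → (ℕ ↪ ℝ)) (γ f g : SeqFun) (x : ℕ ↪ ℝ) :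
    coxMul α β γ f g x = f (α x) * g (β x) * γ x := rfl

/-- If a biadditive operation maps generators of two subgroups into a third subgroup, then it maps
all elements of these subgroups there. -/
theorem coxGraph_map₂ {n : ℕ} {H : AddSubgroup (SeqFun × SeqFun)} (p : SeqFun × SeqFun)
    (B B' : SeqFun →+ SeqFun →+ SeqFun)
    (h : ∀ t : BinaryTree Unit, t.numNodes = n →
      (B p.1 (upFrac t), B' p.2 (fun x => -downFrac t x)) ∈ H)
    {q : SeqFun × SeqFun} (hq : q ∈ coxGraph n) : (B p.1 q.1, B' p.2 q.2) ∈ H := by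
  induction hq using AddSubgroup.closure_induction with
  | mem q hq =>
    obtain ⟨t, ht, rfl⟩ := hq
    exact h t ht
  | zero =>
    simp only [Prod.fst_zero, Prod.snd_zero, map_zero]
    exact H.zero_mem
  | add a b _ _ ha hb => simpa using H.add_mem ha hb
  | neg a _ ha => simpa using H.neg_mem ha

/-- On generators this is the recursion of `upFrac` and `downFrac` at a root vertex; both components
are biadditive, so it extends to the whole graph. -/
theorem coxGraph_over {p q : ℕ} {f f' g g' : SeqFun} (hf : (f, f') ∈ coxGraph p)
    (hg : (g, g') ∈ coxGraph q) :
    ((fun x => f x * g (dropSeq (p + 1) x) * (x (p + 1 + q) - x p)⁻¹,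
      fun x => f' x * g' (dropSeq (p + 1) x) * -(x (p + 1) - x 0)⁻¹) : SeqFun × SeqFun) ∈
        coxGraph (p + 1 + q) := by
  refine coxGraph_map₂ (f, f') (coxMul id (dropSeq (p + 1)) fun x => (x (p + 1 + q) - x p)⁻¹)
    (coxMul id (dropSeq (p + 1)) fun x => -(x (p + 1) - x 0)⁻¹) (fun b hb => ?_) hg
  refine coxGraph_map₂ (upFrac b, fun x => -downFrac b x)
    (coxMul id (dropSeq (p + 1)) fun x => (x (p + 1 + q) - x p)⁻¹).flip
    (coxMul id (dropSeq (p + 1)) fun x => -(x (p + 1) - x 0)⁻¹).flip (fun a ha => ?_) hf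
  subst ha hb
  refine coxGraph_congr (mem_coxGraph (.node () a b)) ?_ (fun x => ?_) fun x => ?_
  · simp only [BinaryTree.numNodes]; omega
  · simp [upFrac]
  · simp [downFrac]

/-- On generators this grafts a tree of degree `m` at the leftmost leaf of another. Up-set factors
of the lower tree have all their variables shifted, whereas its down-set factors keep `x 0` as their
leftmost variable; hence `dropSeq` on one side and `skipSeq` on the other. -/
theorem coxGraph_mul {m q : ℕ} {f f' g g' : SeqFun} (hf : (f, f') ∈ coxGraph m)
    (hg : (g, g') ∈ coxGraph q) :
    ((fun x => f x * g (dropSeq m x), fun x => -(f' x * g' (skipSeq m x))) : SeqFun × SeqFun) ∈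
      coxGraph (m + q) := by
  have key : ∀ t : BinaryTree Unit, ((fun x => f x * upFrac t (dropSeq m x),
      fun x => f' x * downFrac t (skipSeq m x)) : SeqFun × SeqFun) ∈
        coxGraph (m + t.numNodes) := by
    intro t
    induction t with
    | nil => simpa [upFrac, downFrac, BinaryTree.numNodes] using hf
    | node _ a b iha _ =>
      refine coxGraph_congr (coxGraph_over iha (mem_coxGraph b)) ?_ (fun x => ?_) fun x => ?_
      rotate_left
      · simp only [upFrac, dropSeq_apply]
        rw [show dropSeq (a.numNodes + 1) (dropSeq m x) = dropSeq (m + a.numNodes + 1) x from by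
          ext j; simp only [dropSeq_apply]; congr 1; omega]
        rw [show a.numNodes + 1 + b.numNodes + m = m + a.numNodes + 1 + b.numNodes by omega,
          add_comm m a.numNodes]
        ring
      · simp only [downFrac]
        rw [show dropSeq (a.numNodes + 1) (skipSeq m x) = dropSeq (m + a.numNodes + 1) x from by
          ext j
          rw [dropSeq_apply, skipSeq_of_ne _ _ (by omega), dropSeq_apply]
          congr 1; omega]
        rw [skipSeq_zero, skipSeq_of_ne _ _ (by omega),
          show a.numNodes + 1 + m = m + a.numNodes + 1 by omega]
        ring
      · simp only [BinaryTree.numNodes]; omega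
  have := coxGraph_map₂ (H := coxGraph (m + q)) (f, f')
    (coxMul id (dropSeq m) 1) (coxMul id (skipSeq m) (-1))
    (fun t ht => ?_) hg
  · exact coxGraph_congr this rfl (fun x => by simp) fun x => by simp
  · subst ht
    exact coxGraph_congr (key t) rfl (fun x => by simp) fun x => by simp

/-- Every nonempty tree arises by grafting a tree `∣ ∧ b` at the leftmost leaf of a tree. -/
theorem exists_leftmost (a b : BinaryTree Unit) : ∃ c t : BinaryTree Unit,
    a.numNodes + 1 + b.numNodes = c.numNodes + 1 + t.numNodes ∧
    (∀ x, upFrac (.node () a b) x = upFrac c (dropSeq 1 x) *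
      upFrac t (dropSeq (c.numNodes + 1) x) * (x (c.numNodes + 1) - x 0)⁻¹) ∧
    ∀ x, downFrac (.node () a b) x = downFrac c (dropSeq 1 x) *
      downFrac t (skipSeq (c.numNodes + 1) x) * (x 1 - x 0)⁻¹ := by
  induction a generalizing b with
  | nil =>
    refine ⟨b, .nil, by simp only [BinaryTree.numNodes]; omega, fun x => ?_, fun x => ?_⟩
    · simp only [upFrac, BinaryTree.numNodes]
      rw [zero_add, add_comm 1]; ring
    · simp only [downFrac, BinaryTree.numNodes]
      rw [zero_add]; ring
  | node _ a₁ a₂ ih _ =>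
    obtain ⟨c, t, hn, hu, hd⟩ := ih a₂
    refine ⟨c, .node () t b, by simp only [BinaryTree.numNodes]; omega, fun x => ?_, fun x => ?_⟩
    · rw [upFrac, hu, upFrac]
      simp only [dropSeq_apply, BinaryTree.numNodes]
      rw [show a₁.numNodes + a₂.numNodes + 1 = c.numNodes + 1 + t.numNodes by omega,
        show dropSeq (t.numNodes + 1) (dropSeq (c.numNodes + 1) x) =
          dropSeq (c.numNodes + 1 + t.numNodes + 1) x from by
            ext j; simp only [dropSeq_apply]; congr 1; omega,
        show t.numNodes + 1 + b.numNodes + (c.numNodes + 1) =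
          c.numNodes + 1 + t.numNodes + 1 + b.numNodes by omega,
        show t.numNodes + (c.numNodes + 1) = c.numNodes + 1 + t.numNodes by omega]
      ring
    · rw [downFrac, hd, downFrac]
      simp only [BinaryTree.numNodes]
      rw [show a₁.numNodes + a₂.numNodes + 1 = c.numNodes + 1 + t.numNodes by omega,
        show dropSeq (t.numNodes + 1) (skipSeq (c.numNodes + 1) x) =
          dropSeq (c.numNodes + 1 + t.numNodes + 1) x from by
            ext j
            rw [dropSeq_apply, skipSeq_of_ne _ _ (by omega), dropSeq_apply]
            congr 1; omega,
        skipSeq_zero, skipSeq_of_ne _ _ (by omega),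
        show t.numNodes + 1 + (c.numNodes + 1) = c.numNodes + 1 + t.numNodes + 1 by omega]
      ring

/-- This treats a new vertex with the factor `1 / (x last - x 0)` of `treeFrac`, which is not the
factor of an up-set. Partial fractions reduce it to grafting and to joining at a root, for the
smaller tree left after removing a leftmost piece. -/
theorem upFrac_between_mem (n : ℕ) (t : BinaryTree Unit) (ht : t.numNodes = n) {q : ℕ}
    {u u' : SeqFun} (hu : (u, u') ∈ coxGraph q) :
    ((fun x => upFrac t x * u (dropSeq (n + 1) x) * (x (n + 1 + q) - x 0)⁻¹,
      fun x => downFrac t (swapSeq (n + 1) x) * u' (dropSeq (n + 1) x) *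
        (x (n + 1) - x 0)⁻¹) : SeqFun × SeqFun) ∈ coxGraph (n + 1 + q) := by
  induction n using Nat.strong_induction_on generalizing t with
  | _ n ih =>
  cases t with
  | nil =>
    subst ht
    refine coxGraph_congr (coxGraph_over one_mem_coxGraph hu) rfl (fun x => ?_) fun x => ?_
    · simp [upFrac, BinaryTree.numNodes]
    · simp [downFrac, BinaryTree.numNodes]
  | node _ a b =>
    obtain ⟨c, t, hn, hup, hdown⟩ := exists_leftmost a b
    simp only [BinaryTree.numNodes] at ht
    have hn' : n = c.numNodes + 1 + t.numNodes := by omega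
    have hw := ih t.numNodes (by omega) t rfl
    -- With `m = c.numNodes + 1` and `N = n + 1 + q`, the product of `1 / (x m - x 0)` and `1 / (x N
    -- - x 0)` is their difference divided by `x N - x m`. The pairs `h₁` and `h₂` are the two
    -- terms; the divisor belongs to the inductive pair `hw`.
    have h₁ := coxGraph_mul (mem_coxGraph (.node () .nil c)) hw
    have h₂ := coxGraph_over one_mem_coxGraph (coxGraph_mul (mem_coxGraph c) hw)
    have e₁ : BinaryTree.numNodes (.node () .nil c) = c.numNodes + 1 := by
      simp only [BinaryTree.numNodes]; omega
    rw [e₁, show c.numNodes + 1 + (t.numNodes + 1 + q) = n + 1 + q by omega] at h₁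
    rw [show 0 + 1 + (c.numNodes + (t.numNodes + 1 + q)) = n + 1 + q by omega] at h₂
    have e₂ (x : ℕ ↪ ℝ) : dropSeq (t.numNodes + 1) (dropSeq (c.numNodes + 1) x) =
        dropSeq (n + 1) x := by ext j; simp only [dropSeq_apply]; congr 1; omega
    have e₃ (x : ℕ ↪ ℝ) : dropSeq (c.numNodes) (dropSeq 1 x) = dropSeq (c.numNodes + 1) x := rfl
    refine coxGraph_congr (AddSubgroup.sub_mem _ h₁ h₂) rfl (fun x => ?_) fun x => ?_
    · rw [hup]
      simp only [ upFrac, BinaryTree.numNodes, dropSeq_apply, Pi.sub_apply,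
        zero_add, one_mul, e₃, e₂]
      rw [show t.numNodes + 1 + q + (c.numNodes + 1) = n + 1 + q by omega,
        add_comm 1 c.numNodes]
      have h₁ := sub_ne_zero_of_lt x (show 0 < c.numNodes + 1 by omega)
      have h₂ := sub_ne_zero_of_lt x (show 0 < n + 1 + q by omega)
      have h₃ := sub_ne_zero_of_lt x (show c.numNodes + 1 < n + 1 + q by omega)
      field_simp
      ring
    · rw [hdown]
      have e₄ : dropSeq (t.numNodes + 1) (skipSeq (c.numNodes + 1) x) = dropSeq (n + 1) x := by
        ext j
        rw [dropSeq_apply, skipSeq_of_ne _ _ (by omega), dropSeq_apply]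
        congr 1; omega
      have e₅ : dropSeq (t.numNodes + 1) (skipSeq c.numNodes (dropSeq 1 x)) =
          dropSeq (n + 1) x := by
        ext j
        rw [dropSeq_apply, skipSeq_of_ne _ _ (by omega), dropSeq_apply, dropSeq_apply]
        congr 1; omega
      have e₆ : downFrac t (swapSeq (t.numNodes + 1) (skipSeq (c.numNodes + 1) x)) =
          downFrac t (skipSeq (c.numNodes + 1) (swapSeq (n + 1) x)) := by
        refine downFrac_congr t fun j hj => ?_
        rcases Nat.eq_zero_or_pos j with rfl | hj'
        · rw [swapSeq_zero, skipSeq_zero, swapSeq_zero, skipSeq_of_ne _ _ (by omega)]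
          congr 1; omega
        · rw [swapSeq_of_ne _ (by omega) (by omega), skipSeq_of_ne _ _ (by omega),
            skipSeq_of_ne _ _ (by omega), swapSeq_of_ne _ (by omega) (by omega)]
      have e₇ : downFrac t (swapSeq (t.numNodes + 1) (skipSeq c.numNodes (dropSeq 1 x))) =
          downFrac t (skipSeq (c.numNodes + 1) (swapSeq (n + 1) x)) := by
        refine downFrac_congr t fun j hj => ?_
        rcases Nat.eq_zero_or_pos j with rfl | hj'
        · rw [swapSeq_zero, skipSeq_zero, swapSeq_zero, skipSeq_of_ne _ _ (by omega), dropSeq_apply]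
          congr 1; omega
        · rw [swapSeq_of_ne _ (by omega) (by omega), skipSeq_of_ne _ _ (by omega),
            skipSeq_of_ne _ _ (by omega), swapSeq_of_ne _ (by omega) (by omega), dropSeq_apply]
          congr 1
      have e₈ : downFrac c (dropSeq 1 (swapSeq (n + 1) x)) = downFrac c (dropSeq 1 x) := by
        refine downFrac_congr c fun j hj => ?_
        rw [dropSeq_apply, dropSeq_apply, swapSeq_of_ne _ (by omega) (by omega)]
      simp only [downFrac, BinaryTree.numNodes, Pi.sub_apply,
        zero_add, one_mul, e₄, e₅, e₆, e₇, e₈, skipSeq_zero, dropSeq_apply]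
      rw [skipSeq_of_ne _ _ (by omega), skipSeq_of_ne _ _ (by omega), dropSeq_apply,
        swapSeq_zero, swapSeq_of_ne _ (by omega) (by omega),
        show t.numNodes + 1 + (c.numNodes + 1) = n + 1 by omega,
        show t.numNodes + 1 + c.numNodes + 1 = n + 1 by omega]
      have h₁ := sub_ne_zero_of_lt x (show 0 < 1 by omega)
      have h₂ := sub_ne_zero_of_lt x (show 0 < n + 1 by omega)
      have h₃ := sub_ne_zero_of_lt x (show 1 < n + 1 by omega)
      have h₄ : x 1 - x (n + 1) ≠ 0 := by rwa [← neg_sub, neg_ne_zero]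
      field_simp
      ring

theorem coxGraph_between {p q : ℕ} {f f' u u' : SeqFun} (hf : (f, f') ∈ coxGraph p)
    (hu : (u, u') ∈ coxGraph q) :
    ((fun x => f x * u (dropSeq (p + 1) x) * (x (p + 1 + q) - x 0)⁻¹,
      fun x => f' (swapSeq (p + 1) x) * u' (dropSeq (p + 1) x) * -(x (p + 1) - x 0)⁻¹) :
        SeqFun × SeqFun) ∈ coxGraph (p + 1 + q) := by
  refine coxGraph_map₂ (u, u')
    (coxMul id (dropSeq (p + 1)) fun x => (x (p + 1 + q) - x 0)⁻¹).flip
    (coxMul (swapSeq (p + 1)) (dropSeq (p + 1)) fun x => -(x (p + 1) - x 0)⁻¹).flip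
    (fun t ht => ?_) hf
  exact coxGraph_congr (upFrac_between_mem p t ht hu) rfl (fun x => by simp) fun x => by simp

/-- The Coxeter transformation maps the fraction of a down-set to the rotated fraction of the
up-set, up to a sign. -/
theorem downFrac_mem_coxGraph (t : BinaryTree Unit) :
    ((downFrac t, fun x => (-1) ^ (t.numNodes + 1) * upFrac t (rotSeq t.numNodes x)) :
      SeqFun × SeqFun) ∈ coxGraph t.numNodes := by
  induction t with
  | nil => simpa [upFrac, downFrac, BinaryTree.numNodes] using one_mem_coxGraph
  | node _ a b iha ihb =>
    -- The fraction `downFrac (a ∧ b)` is `downFrac a`, times the factor of a vertex over `a` with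
    -- empty right part (`q = 0`), times the shifted `downFrac b`.
    have h := coxGraph_mul (coxGraph_between iha one_mem_coxGraph) ihb
    have e : BinaryTree.numNodes (.node () a b) = a.numNodes + 1 + 0 + b.numNodes := by
      simp only [BinaryTree.numNodes]; omega
    rw [e]
    refine coxGraph_congr h rfl (fun x => ?_) fun x => ?_
    · simp only [downFrac, add_zero]; ring
    · simp only [upFrac, add_zero]
      -- The full rotation restricts to the two smaller ones: `a` sees `x 1, …, x (a.numNodes + 1)`,
      -- and `b` sees the remaining variables followed by `x 0`.
      have e₁ : upFrac a (rotSeq (a.numNodes + 1 + b.numNodes) x) =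
          upFrac a (rotSeq a.numNodes (swapSeq (a.numNodes + 1) x)) := by
        refine upFrac_congr a fun j hj => ?_
        rw [rotSeq_of_lt _ (by omega)]
        rcases hj.lt_or_eq with hj | rfl
        · rw [rotSeq_of_lt _ hj, swapSeq_of_ne _ (by omega) (by omega)]
        · rw [rotSeq_self, swapSeq_zero]
      have e₂ : upFrac b (dropSeq (a.numNodes + 1) (rotSeq (a.numNodes + 1 + b.numNodes) x)) =
          upFrac b (rotSeq b.numNodes (skipSeq (a.numNodes + 1) x)) := by
        refine upFrac_congr b fun j hj => ?_
        rw [dropSeq_apply]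
        rcases hj.lt_or_eq with hj | rfl
        · rw [rotSeq_of_lt _ hj, skipSeq_of_ne _ _ (by omega), rotSeq_of_lt _ (by omega)]
          congr 1; omega
        · rw [rotSeq_self, skipSeq_zero, add_comm, rotSeq_self]
      rw [e₁, e₂, rotSeq_self, rotSeq_of_lt _ (by omega), ← neg_sub (x (a.numNodes + 1)), inv_neg]
      ring

/-! ### Periodicity -/

instance (n : ℕ) : Fintype (Tamari n) :=
  Fintype.subtype (BinaryTree.treesOfNumNodesEq n) fun _ => BinaryTree.mem_treesOfNumNodesEq

open scoped Classical in
/-- The indicator function of the elements above `v`. -/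
noncomputable def upVec {P : Type*} [PartialOrder P] (v : P) : P → ℤ :=
  fun w => if v ≤ w then 1 else 0

open scoped Classical in
/-- The indicator function of the elements below `v`. -/
noncomputable def downVec {P : Type*} [PartialOrder P] (v : P) : P → ℤ :=
  fun w => if w ≤ v then 1 else 0

/-- The matrix of the order relation is unitriangular, so the basis vectors are recovered by
induction from the top. -/
theorem closure_upVec (P : Type*) [PartialOrder P] [Finite P] :
    AddSubgroup.closure (Set.range (upVec (P := P))) = ⊤ := by
  classical
  have := Fintype.ofFinite P
  have key (v : P) : (Pi.single v 1 : P → ℤ) ∈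
      AddSubgroup.closure (Set.range (upVec (P := P))) := by
    induction v using (wellFounded_gt (α := P)).induction with
    | _ v ih =>
    have : (Pi.single v 1 : P → ℤ) = upVec v - ∑ w with v < w, Pi.single w 1 := by
      ext u
      simp only [Pi.sub_apply, upVec, Finset.sum_apply, Pi.single_apply, Finset.sum_ite_eq,
        Finset.mem_filter, Finset.mem_univ, true_and]
      rcases eq_or_ne u v with rfl | h
      · simp
      · by_cases h' : v ≤ u
        · simp [h, h', lt_of_le_of_ne h' h.symm]
        · simp [h, h', mt le_of_lt h']
    rw [this]
    refine AddSubgroup.sub_mem _ (AddSubgroup.subset_closure ⟨v, rfl⟩)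
      (AddSubgroup.sum_mem _ fun w hw => ih w (Finset.mem_filter.1 hw).2)
  rw [eq_top_iff]
  intro a _
  have : a = ∑ v, a v • (Pi.single v 1 : P → ℤ) := by
    ext u
    simp [Finset.sum_apply, Pi.single_apply]
  rw [this]
  exact AddSubgroup.sum_mem _ fun v _ => AddSubgroup.zsmul_mem _ (key v) _

/-! ### Linear combinations of trees as fractions. -/

/-- The fraction of a linear combination of trees. -/
noncomputable def fracMap (n : ℕ) : (Tamari n → ℤ) →ₗ[ℤ] SeqFun :=
  Fintype.linearCombination ℤ fun w : Tamari n => treeFrac w.1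

theorem fracMap_upVec {n : ℕ} (v : Tamari n) : fracMap n (upVec v) = upFrac v.1 := by
  classical
  ext x
  rw [← sum_above, ← List.sum_toFinset _ (above_nodup _), fracMap,
    Fintype.linearCombination_apply, Finset.sum_apply]
  simp only [upVec, ite_smul, one_smul, zero_smul, apply_ite (fun f : SeqFun => f x),
    Pi.zero_apply]
  rw [← Finset.sum_filter]
  refine Finset.sum_bij (fun w _ => w.1) (fun w hw => ?_) (fun w _ w' _ h => Subtype.ext h)
    (fun t ht => ?_) fun w _ => rfl
  · rw [List.mem_toFinset, mem_above_iff]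
    exact (Finset.mem_filter.1 hw).2
  · rw [List.mem_toFinset] at ht
    exact ⟨⟨t, (numNodes_of_mem_above ht).trans v.2⟩,
      Finset.mem_filter.2 ⟨Finset.mem_univ _, mem_above_iff.1 ht⟩, rfl⟩

theorem fracMap_downVec {n : ℕ} (v : Tamari n) : fracMap n (downVec v) = downFrac v.1 := by
  classical
  ext x
  rw [← sum_below, ← List.sum_toFinset _ (below_nodup _), fracMap,
    Fintype.linearCombination_apply, Finset.sum_apply]
  simp only [downVec, ite_smul, one_smul, zero_smul, apply_ite (fun f : SeqFun => f x),
    Pi.zero_apply]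
  rw [← Finset.sum_filter]
  refine Finset.sum_bij (fun w _ => w.1) (fun w hw => ?_) (fun w _ w' _ h => Subtype.ext h)
    (fun t ht => ?_) fun w _ => rfl
  · rw [List.mem_toFinset, mem_below_iff]
    exact (Finset.mem_filter.1 hw).2
  · rw [List.mem_toFinset] at ht
    exact ⟨⟨t, (numNodes_of_mem_below ht).trans v.2⟩,
      Finset.mem_filter.2 ⟨Finset.mem_univ _, mem_below_iff.1 ht⟩, rfl⟩

/-- Every vector is a combination of the `upVec v`, whose images are the fractions of pairwise
distinct codes, hence independent. -/
theorem fracMap_injective (n : ℕ) : Function.Injective (fracMap n) := by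
  classical
  rw [injective_iff_map_eq_zero]
  intro a ha
  have ha' : a ∈ AddSubgroup.closure (Set.range (upVec (P := Tamari n))) := by
    rw [closure_upVec]; trivial
  obtain ⟨c, rfl⟩ : ∃ c : Tamari n → ℤ, a = ∑ v, c v • upVec v := by
    clear ha
    induction ha' using AddSubgroup.closure_induction with
    | mem a h =>
      obtain ⟨v, rfl⟩ := h
      exact ⟨Pi.single v 1, by simp [Pi.single_apply, ite_smul]⟩
    | zero => exact ⟨0, by simp⟩
    | add a b _ _ ha hb =>
      obtain ⟨c, rfl⟩ := ha
      obtain ⟨d, rfl⟩ := hb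
      exact ⟨c + d, by simp [add_smul, Finset.sum_add_distrib]⟩
    | neg a _ ha =>
      obtain ⟨c, rfl⟩ := ha
      exact ⟨-c, by simp⟩
  have hinj : Function.Injective fun v : Tamari n => code v.1 :=
    fun v w h => Subtype.ext (code_injective h)
  have hc (v : Tamari n) : (c v : ℝ) = 0 := by
    have := codeFrac_linearIndependent n (Finset.univ.image fun v : Tamari n => code v.1)
      (Function.extend (fun v : Tamari n => code v.1) (fun v => (c v : ℝ)) 0)
      (by simp only [Finset.mem_image, Finset.mem_univ, true_and]
          rintro _ ⟨v, rfl⟩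
          rw [length_code, v.2]) (fun x => ?_) (code v.1)
      (Finset.mem_image_of_mem _ (Finset.mem_univ _))
    · rwa [hinj.extend_apply (fun v : Tamari n => (c v : ℝ))] at this
    · rw [Finset.sum_image fun _ _ _ _ h => hinj h]
      have := congrFun ha x
      simp only [map_sum, map_zsmul, fracMap_upVec, Finset.sum_apply, Pi.smul_apply,
        Pi.zero_apply, upFrac_eq_codeFrac] at this
      rw [← this]
      exact Finset.sum_congr rfl fun w _ => by
        rw [hinj.extend_apply (fun v : Tamari n => (c v : ℝ)), zsmul_eq_mul]
  refine Finset.sum_eq_zero fun v _ => ?_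
  rw [show c v = 0 from by exact_mod_cast hc v, zero_smul]

/-! ### Order of the rotation of variables. -/

theorem rotIndex_iterate {n : ℕ} (k j : ℕ) (hj : j ≤ n) :
    (rotIndex n)^[k] j = (j + k) % (n + 1) := by
  induction k with
  | zero => exact (Nat.mod_eq_of_lt (Nat.lt_succ_of_le hj)).symm
  | succ k ih =>
    rw [Function.iterate_succ_apply', ih, rotIndex, ← add_assoc, Nat.add_mod (j + k) 1]
    have h : (j + k) % (n + 1) < n + 1 := Nat.mod_lt _ n.succ_pos
    rcases (Nat.lt_succ_iff.1 h).lt_or_eq with h | h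
    · rw [if_pos h, Nat.mod_eq_of_lt (a := 1) (by omega),
        Nat.mod_eq_of_lt (a := (j + k) % (n + 1) + 1) (by omega)]
    · rw [if_neg (by omega), if_pos h, h]
      -- For `n = 0` the modulus is `1`, and `1 % 1` is `0` instead of `1`.
      rcases n with _ | n
      · simp
      · rw [Nat.mod_eq_of_lt (a := 1) (by omega), Nat.mod_self]

theorem rotSeq_iterate_apply (n k : ℕ) (x : ℕ ↪ ℝ) (j : ℕ) :
    (rotSeq n)^[k] x j = x ((rotIndex n)^[k] j) := by
  induction k generalizing x with
  | zero => rfl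
  | succ k ih => rw [Function.iterate_succ_apply, ih, Function.iterate_succ_apply']; rfl

theorem rotSeq_iterate (n : ℕ) (x : ℕ ↪ ℝ) : (rotSeq n)^[n + 1] x = x := by
  ext j
  rw [rotSeq_iterate_apply]
  rcases le_or_gt j n with h | h
  · rw [rotIndex_iterate _ _ h, Nat.add_mod_right, Nat.mod_eq_of_lt (by omega)]
  · congr 1
    exact Function.iterate_fixed (by rw [rotIndex, if_neg (by omega), if_neg (by omega)]) _

/-- An endomorphism of an abelian group generated by elements indexed by the Tamari poset, that maps
the sum over each principal up-set to the opposite of the sum over the principal down-set, is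
periodic of period `2 * n + 2`. -/
theorem pow_eq_one_of_map_upVec {n : ℕ} {G : Type*} [AddCommGroup G] (s : (Tamari n → ℤ) →+ G)
    (hs : Function.Surjective s) (θ : AddMonoid.End G)
    (hθ : ∀ v, θ (s (upVec v)) = -s (downVec v)) : θ ^ (2 * n + 2) = 1 := by
  -- Membership in `coxGraph` is translated back into a value of `θ`; only lifts along `s` are
  -- compared, so `s` need not be injective.
  have hgraph (p : SeqFun × SeqFun) (hp : p ∈ coxGraph n) : ∃ a b : Tamari n → ℤ,
      fracMap n a = p.1 ∧ fracMap n b = p.2 ∧ θ (s a) = s b := by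
    induction hp using AddSubgroup.closure_induction with
    | mem p h =>
      obtain ⟨t, ht, rfl⟩ := h
      obtain ⟨v, rfl⟩ : ∃ v : Tamari n, v.1 = t := ⟨⟨t, ht⟩, rfl⟩
      refine ⟨upVec v, -downVec v, fracMap_upVec _, ?_, ?_⟩
      · rw [map_neg, fracMap_downVec]; rfl
      · rw [hθ, map_neg]
    | zero => exact ⟨0, 0, by simp⟩
    | add p q _ _ hp hq =>
      obtain ⟨a, b, h₁, h₂, h₃⟩ := hp
      obtain ⟨a', b', h₁', h₂', h₃'⟩ := hq
      exact ⟨a + a', b + b', by simp [h₁, h₁'], by simp [h₂, h₂'], by simp [h₃, h₃']⟩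
    | neg p _ hp =>
      obtain ⟨a, b, h₁, h₂, h₃⟩ := hp
      exact ⟨-a, -b, by simp [h₁], by simp [h₂], by simp [h₃]⟩
  -- The square of `θ` acts on fractions as `(-1) ^ n` times the rotation of variables.
  have hsq (a : Tamari n → ℤ) : ∃ b, θ (θ (s a)) = s b ∧
      ∀ x, fracMap n b x = (-1) ^ n * fracMap n a (rotSeq n x) := by
    have ha : a ∈ AddSubgroup.closure (Set.range (upVec (P := Tamari n))) := by
      rw [closure_upVec]; trivial
    induction ha using AddSubgroup.closure_induction with
    | mem a h =>
      obtain ⟨v, rfl⟩ := h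
      have hv : v.1.numNodes = n := v.2
      have hmem := downFrac_mem_coxGraph v.1
      rw [hv] at hmem
      obtain ⟨a, b, h₁, h₂, h₃⟩ := hgraph _ hmem
      obtain rfl : a = downVec v :=
        fracMap_injective _ (h₁.trans (fracMap_downVec _).symm)
      refine ⟨-b, by rw [hθ, map_neg, h₃, map_neg], fun x => ?_⟩
      rw [map_neg, Pi.neg_apply, h₂, fracMap_upVec, pow_succ]
      ring
    | zero => exact ⟨0, by simp⟩
    | add a b _ _ ha hb =>
      obtain ⟨a', ha, ha'⟩ := ha
      obtain ⟨b', hb, hb'⟩ := hb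
      exact ⟨a' + b', by simp [ha, hb], fun x => by simp [ha', hb', mul_add]⟩
    | neg a _ ha =>
      obtain ⟨a', ha, ha'⟩ := ha
      exact ⟨-a', by simp [ha], fun x => by simp [ha']⟩
  have hiter (k : ℕ) (a : Tamari n → ℤ) : ∃ b, (θ ^ (2 * k)) (s a) = s b ∧
      ∀ x, fracMap n b x = ((-1) ^ n) ^ k * fracMap n a ((rotSeq n)^[k] x) := by
    induction k with
    | zero => exact ⟨a, by simp, by simp⟩
    | succ k ih =>
      obtain ⟨b, hb, hb'⟩ := ih
      obtain ⟨c, hc, hc'⟩ := hsq b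
      refine ⟨c, ?_, fun x => ?_⟩
      · rw [← hc, ← hb, mul_add, add_comm, pow_add, mul_one, sq]; rfl
      · rw [hc', hb', Function.iterate_succ_apply, pow_succ]; ring
  ext g
  obtain ⟨a, rfl⟩ := hs g
  obtain ⟨b, hb, hb'⟩ := hiter (n + 1) a
  obtain rfl : b = a := by
    refine fracMap_injective n (funext fun x => ?_)
    -- After `n + 1` squares the rotation is trivial and the accumulated sign is `(-1) ^ (n * (n +
    -- 1))`.
    rw [hb', rotSeq_iterate, ← pow_mul, (Nat.even_mul_succ_self n).neg_one_pow, one_mul]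
  exact hb

/-! ### Serre pairs in linear triangulated categories -/

/-- The range of a transpose is the annihilator of the kernel, in any dimension. This is how linear
forms are produced in the diagram chases below. -/
theorem exists_comp_eq_of_ker_le {k U V : Type*} [Field k] [AddCommGroup U] [Module k U]
    [AddCommGroup V] [Module k V] (L : U →ₗ[k] V) (μ : U →ₗ[k] k)
    (h : ∀ u, L u = 0 → μ u = 0) : ∃ l : V →ₗ[k] k, ∀ u, l (L u) = μ u := by
  have : μ ∈ L.dualMap.range := by
    rw [LinearMap.range_dualMap_eq_dualAnnihilator_ker, Submodule.mem_dualAnnihilator]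
    exact h
  obtain ⟨l, hl⟩ := this
  exact ⟨l, fun u => LinearMap.congr_fun hl u⟩

section Serre

variable {k : Type*} [Field k] {D : Type*} [Category D] [Preadditive D] [Linear k D]

/-- The map `Hom(Y, W) → Hom(X, Y)^*` induced by a linear form on `Hom(X, W)`. -/
def serreMap {X W : D} (t : (X ⟶ W) →ₗ[k] k) (Y : D) : (Y ⟶ W) →ₗ[k] Module.Dual k (X ⟶ Y) where
  toFun g := t ∘ₗ Linear.rightComp k X g
  map_add' g g' := by ext; simp
  map_smul' r g := by ext; simp

@[simp] theorem serreMap_apply {X W : D} (t : (X ⟶ W) →ₗ[k] k) (Y : D) (g : Y ⟶ W) (f : X ⟶ Y) :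
    serreMap t Y g f = t (f ≫ g) := rfl

/-- The linear form `t` on `Hom(X, W)` exhibits `W` as a Serre dual of `X`. -/
def IsSerreForm {X W : D} (t : (X ⟶ W) →ₗ[k] k) : Prop :=
  ∀ Y : D, Function.Bijective (serreMap t Y)

theorem IsSerreForm.eq_zero {X W : D} {t : (X ⟶ W) →ₗ[k] k} (ht : IsSerreForm t) {Y : D}
    {g : Y ⟶ W} (h : ∀ f : X ⟶ Y, t (f ≫ g) = 0) : g = 0 :=
  (ht Y).injective (by ext f; simp [h])

theorem IsSerreForm.eq {X W : D} {t : (X ⟶ W) →ₗ[k] k} (ht : IsSerreForm t) {Y : D}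
    {g g' : Y ⟶ W} (h : ∀ f : X ⟶ Y, t (f ≫ g) = t (f ≫ g')) : g = g' :=
  (ht Y).injective (by ext f; simp [h])

theorem IsSerreForm.exists_eq {X W : D} {t : (X ⟶ W) →ₗ[k] k} (ht : IsSerreForm t) {Y : D}
    (l : (X ⟶ Y) →ₗ[k] k) : ∃ g : Y ⟶ W, ∀ f : X ⟶ Y, t (f ≫ g) = l f := by
  obtain ⟨g, hg⟩ := (ht Y).surjective l
  exact ⟨g, fun f => LinearMap.congr_fun hg f⟩

theorem IsSerreForm.mk {X W : D} {t : (X ⟶ W) →ₗ[k] k}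
    (h₁ : ∀ (Y : D) (g : Y ⟶ W), (∀ f : X ⟶ Y, t (f ≫ g) = 0) → g = 0)
    (h₂ : ∀ (Y : D) (l : (X ⟶ Y) →ₗ[k] k), ∃ g : Y ⟶ W, ∀ f : X ⟶ Y, t (f ≫ g) = l f) :
    IsSerreForm t := by
  intro Y
  refine ⟨fun g g' h => ?_, fun l => ?_⟩
  · rw [← sub_eq_zero]
    refine h₁ Y _ fun f => ?_
    have := LinearMap.congr_fun h f
    simp only [serreMap_apply] at this
    rw [Preadditive.comp_sub, map_sub, this, sub_self]
  · obtain ⟨g, hg⟩ := h₂ Y l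
    exact ⟨g, LinearMap.ext hg⟩

theorem IsSerreForm.of_iso {X W X' W' : D} {t : (X ⟶ W) →ₗ[k] k} (ht : IsSerreForm t)
    (e : X ≅ X') (e' : W ≅ W') :
    IsSerreForm (t ∘ₗ Linear.leftComp k W e.hom ∘ₗ Linear.rightComp k X' e'.inv) := by
  refine .mk (fun Y g h => ?_) fun Y l => ?_
  · rw [← cancel_mono e'.inv, zero_comp]
    refine ht.eq_zero fun f => ?_
    simpa using h (e.inv ≫ f)
  · obtain ⟨g, hg⟩ := ht.exists_eq (l ∘ₗ Linear.leftComp k Y e.inv)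
    exact ⟨g ≫ e'.hom, fun f => by simpa using hg (e.hom ≫ f)⟩

/-- The object `W` is a Serre dual of `X`. -/
def IsSerreDual (k : Type*) [Field k] [Linear k D] (X W : D) : Prop :=
  ∃ t : (X ⟶ W) →ₗ[k] k, IsSerreForm t

theorem IsSerreDual.of_iso {X W X' W' : D} (h : IsSerreDual k X W) (e : X ≅ X') (e' : W ≅ W') :
    IsSerreDual k X' W' := by
  obtain ⟨t, ht⟩ := h
  exact ⟨_, ht.of_iso e e'⟩

theorem isSerreDual_of_isZero {X W : D} (hX : IsZero X) (hW : IsZero W) : IsSerreDual k X W :=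
  ⟨0, .mk (fun _ _ _ => hW.eq_of_tgt _ _) fun Y l => ⟨0, fun f => by
    rw [hX.eq_of_src f 0, map_zero, LinearMap.zero_apply]⟩⟩

/-- Both objects represent the functor sending `Y` to the dual of `Hom(X, Y)`. -/
theorem IsSerreDual.nonempty_iso {X W W' : D} (h : IsSerreDual k X W) (h' : IsSerreDual k X W') :
    Nonempty (W ≅ W') := by
  obtain ⟨t, ht⟩ := h
  obtain ⟨t', ht'⟩ := h'
  obtain ⟨u, hu⟩ := ht'.exists_eq t
  obtain ⟨v, hv⟩ := ht.exists_eq t'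
  refine ⟨⟨u, v, ht.eq fun f => ?_, ht'.eq fun f => ?_⟩⟩
  · rw [← Category.assoc, hv, hu, Category.comp_id]
  · rw [← Category.assoc, hu, hv, Category.comp_id]

variable [HasShift D ℤ] [∀ n : ℤ, (shiftFunctor D n).Additive]
  [∀ n : ℤ, (shiftFunctor D n).Linear k]

/-- The linear form on `Hom(X⟦n⟧, W⟦n⟧)` corresponding to a linear form on `Hom(X, W)`. -/
noncomputable def shiftForm {X W : D} (t : (X ⟶ W) →ₗ[k] k) (n : ℤ) :
    (X⟦n⟧ ⟶ W⟦n⟧) →ₗ[k] k :=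
  t ∘ₗ (LinearEquiv.ofBijective ((shiftFunctor D n).mapLinearMap k (X := X) (Y := W))
    ⟨(shiftFunctor D n).map_injective, (shiftFunctor D n).map_surjective⟩).symm.toLinearMap

@[simp] theorem shiftForm_map {X W : D} (t : (X ⟶ W) →ₗ[k] k) (n : ℤ) (f : X ⟶ W) :
    shiftForm t n (f⟦n⟧') = t f :=
  congrArg t ((LinearEquiv.ofBijective ((shiftFunctor D n).mapLinearMap k (X := X) (Y := W))
    ⟨(shiftFunctor D n).map_injective, (shiftFunctor D n).map_surjective⟩).symm_apply_apply f)

theorem IsSerreForm.shift {X W : D} {t : (X ⟶ W) →ₗ[k] k} (ht : IsSerreForm t) (n : ℤ) :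
    IsSerreForm (shiftForm t n) := by
  refine .mk (fun Y g h => ?_) fun Y l => ?_
  · let e := (shiftFunctor D n).objObjPreimageIso Y
    obtain ⟨g', hg'⟩ := (shiftFunctor D n).map_surjective (e.hom ≫ g)
    have : g' = 0 := ht.eq_zero fun f => by
      have := h (f⟦n⟧' ≫ e.hom)
      rwa [Category.assoc, ← hg', ← Functor.map_comp, shiftForm_map] at this
    rw [← cancel_epi e.hom, ← hg', this, Functor.map_zero, comp_zero]
  · let e := (shiftFunctor D n).objObjPreimageIso Y
    obtain ⟨g, hg⟩ := ht.exists_eq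
      (l ∘ₗ Linear.rightComp k _ e.hom ∘ₗ (shiftFunctor D n).mapLinearMap k)
    refine ⟨e.inv ≫ g⟦n⟧', fun f => ?_⟩
    obtain ⟨f', hf'⟩ := (shiftFunctor D n).map_surjective (f ≫ e.inv)
    rw [← Category.assoc, ← hf', ← Functor.map_comp, shiftForm_map, hg]
    simp [hf']

theorem IsSerreDual.shift {X W : D} (h : IsSerreDual k X W) (n : ℤ) :
    IsSerreDual k (X⟦n⟧) (W⟦n⟧) := by
  obtain ⟨t, ht⟩ := h
  exact ⟨_, ht.shift n⟩

/-! ### Serre duals in distinguished triangles. -/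

variable [HasZeroObject D] [Pretriangulated D]

theorem exists_rotated_completion {T V : Triangle D} (hT : T ∈ distTriang D)
    (hV : V ∈ distTriang D) (φ : T.obj₂ ⟶ V.obj₁) (ψ : T.obj₃ ⟶ V.obj₂)
    (h : T.mor₂ ≫ ψ = φ ≫ V.mor₁) : ∃ χ : T.obj₁⟦(1 : ℤ)⟧ ⟶ V.obj₃,
      T.mor₃ ≫ χ = ψ ≫ V.mor₂ ∧ χ ≫ V.mor₃ = -(T.mor₁ ≫ φ)⟦(1 : ℤ)⟧' := by
  obtain ⟨χ, hχ, hχ'⟩ := complete_distinguished_triangle_morphism T.rotate V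
    (rot_of_distTriang _ hT) hV φ ψ h
  refine ⟨χ, hχ, hχ'.symm.trans ?_⟩
  rw [Functor.map_comp]
  exact Preadditive.neg_comp _ _

theorem exists_eq_mor₁_comp {T : Triangle D} (hT : T ∈ distTriang D) {Y : D} (w : T.obj₁ ⟶ Y)
    (h : T.mor₃ ≫ w⟦(1 : ℤ)⟧' = 0) : ∃ u : T.obj₂ ⟶ Y, w = T.mor₁ ≫ u := by
  obtain ⟨v, hv⟩ := T.rotate.yoneda_exact₃ (rot_of_distTriang _ hT) (w⟦(1 : ℤ)⟧') h
  obtain ⟨u, hu⟩ : ∃ u : T.obj₂ ⟶ Y, u⟦(1 : ℤ)⟧' = v := (shiftFunctor D (1 : ℤ)).map_surjective v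
  refine ⟨-u, (shiftFunctor D (1 : ℤ)).map_injective ?_⟩
  rw [Functor.map_comp, Functor.map_neg, Preadditive.comp_neg, hv, ← hu]
  exact Preadditive.neg_comp _ _

/-- An extension of Serre dual objects along compatible connecting maps is a Serre dual. -/
theorem isSerreDual_of_distTriang {T V : Triangle D} (hT : T ∈ distTriang D)
    (hV : V ∈ distTriang D) {t₁ : (T.obj₁ ⟶ V.obj₁) →ₗ[k] k} {t₃ : (T.obj₃ ⟶ V.obj₃) →ₗ[k] k}
    (h₁ : IsSerreForm t₁) (h₃ : IsSerreForm t₃)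
    (hc : ∀ χ : T.obj₁⟦(1 : ℤ)⟧ ⟶ V.obj₃, shiftForm t₁ 1 (χ ≫ V.mor₃) = -t₃ (T.mor₃ ≫ χ)) :
    IsSerreDual k T.obj₂ V.obj₂ := by
  have h₁' := h₁.shift 1
  -- The form `t₂` is prescribed on morphisms ending in `V.mor₁` by `t₁`, and on those starting with
  -- `T.mor₂` by `t₃`. Where the two prescriptions overlap, completing a square yields `χ`, and `hc`
  -- says that they agree.
  obtain ⟨t₂, ht₂⟩ := exists_comp_eq_of_ker_le
    ((Linear.rightComp k T.obj₂ V.mor₁).coprod (Linear.leftComp k V.obj₂ T.mor₂))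
    ((t₁ ∘ₗ Linear.leftComp k V.obj₁ T.mor₁).coprod (t₃ ∘ₗ Linear.rightComp k T.obj₃ V.mor₂))
    (by
      rintro ⟨φ, ψ⟩ h
      simp only [LinearMap.coprod_apply, Linear.rightComp_apply, Linear.leftComp_apply,
        LinearMap.comp_apply] at h ⊢
      obtain ⟨χ, hχ, hχ'⟩ := exists_rotated_completion hT hV φ (-ψ) (by
        rw [Preadditive.comp_neg, eq_comm, eq_neg_iff_add_eq_zero]
        exact h)
      have key := hc χ
      rw [hχ', hχ, map_neg, shiftForm_map, Preadditive.neg_comp, map_neg, neg_neg] at key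
      rw [← neg_eq_iff_add_eq_zero, key])
  have hA {Y : D} (u : T.obj₂ ⟶ Y) (φ : Y ⟶ V.obj₁) :
      t₂ (u ≫ φ ≫ V.mor₁) = t₁ (T.mor₁ ≫ u ≫ φ) := by
    simpa using ht₂ (u ≫ φ, 0)
  have hB {Y : D} (v : T.obj₃ ⟶ Y) (g : Y ⟶ V.obj₂) :
      t₂ (T.mor₂ ≫ v ≫ g) = t₃ (v ≫ g ≫ V.mor₂) := by
    simpa using ht₂ (0, v ≫ g)
  refine ⟨t₂, .mk (fun Y g hg => ?_) fun Y l => ?_⟩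
  -- Injectivity: a `g` orthogonal to everything factors through `V.mor₁`, and the shift of the
  -- factor `φ` is shown to factor through `V.mor₃`, so the composite is zero.
  · obtain ⟨φ, rfl⟩ := V.coyoneda_exact₂ hV g (h₃.eq_zero fun v => by
      rw [← hB, ← Category.assoc, hg])
    obtain ⟨l, hl⟩ := exists_comp_eq_of_ker_le
      (Linear.leftComp k (Y⟦(1 : ℤ)⟧) T.mor₃ ∘ₗ (shiftFunctor D (1 : ℤ)).mapLinearMap k)
      (t₁ ∘ₗ Linear.rightComp k T.obj₁ φ) (fun w hw => by
        obtain ⟨u, rfl⟩ := exists_eq_mor₁_comp hT w hw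
        have hu := hg u
        rw [hA] at hu
        simpa using hu)
    obtain ⟨ξ, hξ⟩ := h₃.exists_eq l
    have hφ : φ⟦(1 : ℤ)⟧' = -(ξ ≫ V.mor₃) := by
      refine h₁'.eq fun w => ?_
      obtain ⟨w, rfl⟩ := (shiftFunctor D (1 : ℤ)).map_surjective w
      have := hl w
      simp only [LinearMap.comp_apply, Functor.coe_mapLinearMap, Linear.leftComp_apply,
        Linear.rightComp_apply] at this
      rw [← Functor.map_comp, shiftForm_map, ← this, ← hξ, Preadditive.comp_neg, map_neg,
        ← Category.assoc, hc, neg_neg, Category.assoc]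
    apply (shiftFunctor D (1 : ℤ)).map_injective
    rw [Functor.map_comp, hφ, Preadditive.neg_comp, Category.assoc,
      comp_distTriang_mor_zero₃₁ _ hV, comp_zero, neg_zero, Functor.map_zero]
  -- Surjectivity: the restriction of `l` along `T.mor₂` is represented by some `β`, which lifts to
  -- `γ`; the error that remains depends only on restriction along `T.mor₁` and is represented
  -- through `V.obj₁`.
  · obtain ⟨β, hβ⟩ := h₃.exists_eq (l ∘ₗ Linear.leftComp k Y T.mor₂)
    obtain ⟨γ, rfl⟩ := V.coyoneda_exact₃ hV β (h₁'.eq_zero fun w => by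
      rw [← Category.assoc, hc, ← Category.assoc, hβ, LinearMap.comp_apply, Linear.leftComp_apply,
        ← Category.assoc, comp_distTriang_mor_zero₂₃ _ hT, zero_comp, map_zero, neg_zero])
    obtain ⟨μ, hμ⟩ := exists_comp_eq_of_ker_le (Linear.leftComp k Y T.mor₁)
      (l - t₂ ∘ₗ Linear.rightComp k T.obj₂ γ) (fun u hu => by
        obtain ⟨v, rfl⟩ := T.yoneda_exact₂ hT u hu
        have := hβ v
        rw [LinearMap.comp_apply, Linear.leftComp_apply] at this
        rw [LinearMap.sub_apply, LinearMap.comp_apply, Linear.rightComp_apply, Category.assoc, hB,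
          this, sub_self])
    obtain ⟨φ, hφ⟩ := h₁.exists_eq μ
    refine ⟨γ + φ ≫ V.mor₁, fun u => ?_⟩
    have := hμ u
    rw [Linear.leftComp_apply, ← hφ, Category.assoc, ← hA, LinearMap.sub_apply,
      LinearMap.comp_apply, Linear.rightComp_apply] at this
    rw [Preadditive.comp_add, map_add, this]
    abel

/-- Given a distinguished triangle whose outer objects have Serre duals, there is a distinguished
triangle of Serre duals. -/
theorem exists_distTriang_of_isSerreDual {T : Triangle D} (hT : T ∈ distTriang D) {W₁ W₃ : D}
    (h₁ : IsSerreDual k T.obj₁ W₁) (h₃ : IsSerreDual k T.obj₃ W₃) :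
    ∃ (W₂ : D) (a : W₁ ⟶ W₂) (b : W₂ ⟶ W₃) (c : W₃ ⟶ W₁⟦(1 : ℤ)⟧),
      Triangle.mk a b c ∈ distTriang D ∧ IsSerreDual k T.obj₂ W₂ := by
  obtain ⟨t₁, h₁⟩ := h₁
  obtain ⟨t₃, h₃⟩ := h₃
  -- The connecting morphism is the transpose of `T.mor₃` under duality; the sign is the one
  -- required by `isSerreDual_of_distTriang`.
  obtain ⟨c, hc⟩ := (h₁.shift 1).exists_eq (-(t₃ ∘ₗ Linear.leftComp k W₃ T.mor₃))
  obtain ⟨W₂, a, b, hV⟩ := distinguished_cocone_triangle₂ c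
  exact ⟨W₂, a, b, c, hV, isSerreDual_of_distTriang hT hV h₁ h₃ hc⟩

/-- If Hom spaces are finite-dimensional, then extensions of Serre duals are Serre duals. -/
theorem exists_isSerreDual_of_distTriang [∀ X Y : D, FiniteDimensional k (X ⟶ Y)]
    {V : Triangle D} (hV : V ∈ distTriang D) {X₁ X₃ : D}
    (h₁ : IsSerreDual k X₁ V.obj₁) (h₃ : IsSerreDual k X₃ V.obj₃) :
    ∃ X₂ : D, IsSerreDual k X₂ V.obj₂ := by
  obtain ⟨t₁, h₁⟩ := h₁
  obtain ⟨t₃, h₃⟩ := h₃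
  -- Here `V.mor₃` has to be transposed backwards: `h₃` turns `l` into an element of the bidual of
  -- `Hom(X₃, X₁⟦1⟧)`, which by finite dimension is evaluation at a morphism `h`.
  let l : Module.Dual k (X₁⟦(1 : ℤ)⟧ ⟶ V.obj₃) :=
    shiftForm t₁ 1 ∘ₗ Linear.rightComp k _ V.mor₃
  let e : Module.Dual k (Module.Dual k (X₃ ⟶ X₁⟦(1 : ℤ)⟧)) :=
    l ∘ₗ (LinearEquiv.ofBijective (serreMap t₃ _) (h₃ _)).symm.toLinearMap
  obtain ⟨h, hh⟩ := (Module.evalEquiv k (X₃ ⟶ X₁⟦(1 : ℤ)⟧)).surjective e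
  obtain ⟨X₂, f, g, hT⟩ := distinguished_cocone_triangle₂ (-h)
  refine ⟨X₂, isSerreDual_of_distTriang hT hV (t₁ := t₁) (t₃ := t₃) h₁ h₃ fun χ => ?_⟩
  have h' : e (serreMap t₃ _ χ) = l χ := congrArg l (LinearEquiv.symm_apply_apply _ _)
  rw [← hh] at h'
  have h'' (χ : X₁⟦(1 : ℤ)⟧ ⟶ V.obj₃) : t₃ ((-h) ≫ χ) = -t₃ (h ≫ χ) := by
    rw [Preadditive.neg_comp, map_neg]
  exact h'.symm.trans ((neg_neg _).symm.trans (congrArg Neg.neg (h'' χ).symm))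

end Serre

section K0

variable {D : Type*} [Category D] [HasZeroObject D] [Preadditive D] [HasShift D ℤ]
  [∀ n : ℤ, (shiftFunctor D n).Additive] [Pretriangulated D]

/-! ### Computations in the Grothendieck group -/

theorem K0.of_distTriang {T : Triangle D} (hT : T ∈ distTriang D) :
    K0.of T.obj₂ = K0.of T.obj₁ + K0.of T.obj₃ := by
  have h : FreeAbelianGroup.of T.obj₂ - (FreeAbelianGroup.of T.obj₁ + FreeAbelianGroup.of T.obj₃) ∈
      k0Relations D := AddSubgroup.subset_closure ⟨T, hT, rfl⟩
  rw [← sub_eq_zero]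
  exact (QuotientAddGroup.eq_zero_iff _).2 h

open scoped ZeroObject in
theorem K0.of_zero : K0.of (0 : D) = 0 := by
  have := K0.of_distTriang (contractible_distinguished (0 : D))
  exact left_eq_add.1 this

open scoped ZeroObject in
theorem K0.of_iso {X Y : D} (e : X ≅ Y) : K0.of X = K0.of Y := by
  have := K0.of_distTriang (isomorphic_distinguished _ (contractible_distinguished X)
    (Triangle.mk e.hom (0 : Y ⟶ 0) 0) (Triangle.isoMk _ _ (Iso.refl X) e.symm (Iso.refl 0)
      (by change e.hom ≫ e.inv = 𝟙 X ≫ 𝟙 X; simp)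
      (by change (0 : Y ⟶ 0) ≫ 𝟙 0 = e.inv ≫ (0 : X ⟶ 0); simp)
      (by change (0 : 0 ⟶ X⟦(1 : ℤ)⟧) ≫ (𝟙 X)⟦(1 : ℤ)⟧' = 𝟙 0 ≫ (0 : 0 ⟶ X⟦(1 : ℤ)⟧); simp)))
  change K0.of Y = K0.of X + K0.of (0 : D) at this
  rw [this, K0.of_zero, add_zero]

open scoped ZeroObject in
theorem K0.of_isZero {X : D} (h : IsZero X) : K0.of X = 0 := by
  rw [K0.of_iso (h.iso (isZero_zero D)), K0.of_zero]

open scoped ZeroObject in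
theorem K0.of_shift_one (X : D) : K0.of (X⟦(1 : ℤ)⟧) = -K0.of X := by
  have := K0.of_distTriang (rot_of_distTriang _ (contractible_distinguished X))
  change K0.of (0 : D) = K0.of X + K0.of (X⟦(1 : ℤ)⟧) at this
  rw [K0.of_zero] at this
  rw [eq_neg_iff_add_eq_zero, add_comm, ← this]

theorem K0.induction {p : K0 D → Prop} (of : ∀ X, p (K0.of X)) (zero : p 0)
    (add : ∀ x y, p x → p y → p (x + y)) (neg : ∀ x, p x → p (-x)) (x : K0 D) : p x := by
  induction x using QuotientAddGroup.induction_on with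
  | H x =>
  induction x using FreeAbelianGroup.induction_on with
  | zero => exact zero
  | of X => exact of X
  | neg X _ => exact neg _ (of X)
  | add x y hx hy => exact add _ _ hx hy

theorem K0.end_ext {θ θ' : AddMonoid.End (K0 D)} (h : ∀ X, θ (K0.of X) = θ' (K0.of X)) :
    θ = θ' := by
  refine AddMonoidHom.ext fun x => ?_
  induction x using K0.induction with
  | of X => exact h X
  | zero => exact (AddMonoidHom.map_zero θ).trans (AddMonoidHom.map_zero θ').symm
  | add x y hx hy =>
    exact (AddMonoidHom.map_add θ x y).trans
      ((congrArg₂ _ hx hy).trans (AddMonoidHom.map_add θ' x y).symm)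
  | neg x hx =>
    exact (AddMonoidHom.map_neg θ x).trans
      ((congrArg _ hx).trans (AddMonoidHom.map_neg θ' x).symm)

end K0

section AuslanderReiten

variable {k : Type*} [Field k] {D : Type*} [Category D] [HasZeroObject D] [Preadditive D]
  [Linear k D] [HasShift D ℤ] [∀ n : ℤ, (shiftFunctor D n).Additive] [Pretriangulated D]

/-! ### The Auslander-Reiten translation -/

/-- As in the Yoneda lemma, naturality in `Y` recovers the duality from the form attached to the
identity. -/
theorem IsAuslanderReitenTranslation.isSerreDual {τ : D ⥤ D}
    (h : IsAuslanderReitenTranslation k τ) (X : D) : IsSerreDual k X ((τ.obj X)⟦(1 : ℤ)⟧) := by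
  obtain ⟨η, hη, -⟩ := h.duality
  refine ⟨η X _ (𝟙 _), fun Y => ?_⟩
  convert! (η X Y).bijective using 1
  ext g f
  rw [serreMap_apply, ← hη, Category.comp_id]

theorem IsCoxeterTransformation.map_of {θ : AddMonoid.End (K0 D)}
    (hθ : IsCoxeterTransformation k θ) {X W : D} (h : IsSerreDual k X W) :
    θ (K0.of X) = -K0.of W := by
  obtain ⟨τ, hτ, hθ⟩ := hθ
  obtain ⟨e⟩ := h.nonempty_iso (hτ.isSerreDual X)
  rw [hθ, K0.of_iso e, K0.of_shift_one, neg_neg]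

/-- A functorial choice of Serre duals. -/
theorem exists_serreFunctor (h : ∀ X : D, ∃ W : D, IsSerreDual k X W) :
    ∃ (S : D ⥤ D) (t : ∀ X, (X ⟶ S.obj X) →ₗ[k] k), (∀ X, IsSerreForm (t X)) ∧
      ∀ {X X' : D} (a : X ⟶ X') (g : X' ⟶ S.obj X), t X' (g ≫ S.map a) = t X (a ≫ g) := by
  choose S t ht using h
  have hmap {X X' : D} (a : X ⟶ X') := (ht X').exists_eq (t X ∘ₗ Linear.leftComp k (S X) a)
  choose m hm using @hmap
  simp only [LinearMap.comp_apply, Linear.leftComp_apply] at hm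
  refine ⟨{ obj := S, map := m, map_id := fun X => ?_, map_comp := fun {X Y Z} a b => ?_ },
    t, ht, hm⟩
  · exact (ht X).eq fun f => by simp [hm]
  · exact (ht Z).eq fun f => by simp [← Category.assoc, hm]

/-- By `hS`, the action of `S` on `Hom(X, X')` is the biduality map followed by Serre duality. Forms
separate morphisms, giving faithfulness; finite dimension makes biduality onto, giving fullness;
uniqueness of Serre duals and `h` give essential surjectivity. -/
theorem isEquivalence_of_serre [∀ X Y : D, FiniteDimensional k (X ⟶ Y)] (S : D ⥤ D)
    (t : ∀ X, (X ⟶ S.obj X) →ₗ[k] k) (ht : ∀ X, IsSerreForm (t X))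
    (hS : ∀ {X X' : D} (a : X ⟶ X') (g : X' ⟶ S.obj X), t X' (g ≫ S.map a) = t X (a ≫ g))
    (h : ∀ W : D, ∃ X : D, IsSerreDual k X W) : S.IsEquivalence where
  faithful := ⟨fun {X X'} a b hab => by
    rw [← sub_eq_zero, ← Module.forall_dual_apply_eq_zero_iff k]
    intro l
    obtain ⟨g, hg⟩ := (ht X).exists_eq l
    rw [← hg, Preadditive.sub_comp, map_sub, ← hS a g, ← hS b g, hab, sub_self]⟩
  full := ⟨fun {X X'} u => by
    let e := LinearEquiv.ofBijective (serreMap (t X) X') (ht X X')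
    obtain ⟨a, ha⟩ := (Module.evalEquiv k (X ⟶ X')).surjective
      ((t X' ∘ₗ Linear.rightComp k X' u) ∘ₗ e.symm.toLinearMap)
    refine ⟨a, (ht X').eq fun g => ?_⟩
    have := LinearMap.congr_fun ha (e g)
    rw [LinearMap.comp_apply, LinearEquiv.coe_coe, LinearEquiv.symm_apply_apply] at this
    rw [hS]
    exact this⟩
  essSurj := ⟨fun W => by
    obtain ⟨X, hX⟩ := h W
    obtain ⟨e⟩ := IsSerreDual.nonempty_iso ⟨t X, ht X⟩ hX
    exact ⟨X, ⟨e⟩⟩⟩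

theorem exists_isAuslanderReitenTranslation [∀ X Y : D, FiniteDimensional k (X ⟶ Y)]
    (h : ∀ X : D, ∃ W : D, IsSerreDual k X W) (h' : ∀ W : D, ∃ X : D, IsSerreDual k X W) :
    ∃ τ : D ⥤ D, IsAuslanderReitenTranslation k τ := by
  obtain ⟨S, t, ht, hS⟩ := exists_serreFunctor h
  have := isEquivalence_of_serre S t ht hS h'
  let i := shiftFunctorCompIsoId D (-1 : ℤ) 1 (by simp)
  refine ⟨S ⋙ shiftFunctor D (-1 : ℤ), inferInstance, fun X Y => LinearEquiv.ofBijective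
    (serreMap (t X) Y ∘ₗ Linear.rightComp k Y (i.hom.app (S.obj X))) ?_, ?_, ?_⟩
  · refine (ht X Y).comp ⟨fun f g hfg => ?_, fun g => ⟨g ≫ i.inv.app _, ?_⟩⟩
    · exact (cancel_mono (i.hom.app (S.obj X))).1 hfg
    · change (g ≫ i.inv.app _) ≫ i.hom.app _ = g
      simp
  · intro X Y Y' g φ f
    change t X (f ≫ (g ≫ φ) ≫ i.hom.app _) = t X ((f ≫ g) ≫ φ ≫ i.hom.app _)
    simp only [Category.assoc]
  · intro X X' Y a φ f
    have := i.hom.naturality (S.map a)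
    change t X' (f ≫ (φ ≫ ((S.map a)⟦(-1 : ℤ)⟧')⟦(1 : ℤ)⟧') ≫ i.hom.app _) =
      t X ((a ≫ f) ≫ φ ≫ i.hom.app _)
    rw [Category.assoc φ]
    erw [this]
    have := hS a (f ≫ φ ≫ i.hom.app _)
    simpa using this

/-- The functor `τ` is not shown to be triangulated. It is enough that the Serre duals of the
vertices of a triangle are the vertices of some distinguished triangle. Uniqueness holds because
Serre duals are unique up to isomorphism. -/
theorem existsUnique_isCoxeterTransformation [∀ n : ℤ, (shiftFunctor D n).Linear k]
    [∀ X Y : D, FiniteDimensional k (X ⟶ Y)]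
    (h : ∀ X : D, ∃ W : D, IsSerreDual k X W) (h' : ∀ W : D, ∃ X : D, IsSerreDual k X W) :
    ∃! θ : AddMonoid.End (K0 D), IsCoxeterTransformation k θ := by
  obtain ⟨τ, hτ⟩ := exists_isAuslanderReitenTranslation h h'
  have hrel : k0Relations D ≤
      (FreeAbelianGroup.lift fun X : D => K0.of (τ.obj X)).ker := by
    refine (AddSubgroup.closure_le _).2 ?_
    rintro _ ⟨T, hT, rfl⟩
    obtain ⟨W₂, a, b, c, hV, h₂⟩ :=
      exists_distTriang_of_isSerreDual hT (hτ.isSerreDual T.obj₁) (hτ.isSerreDual T.obj₃)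
    obtain ⟨e⟩ := h₂.nonempty_iso (hτ.isSerreDual T.obj₂)
    have := K0.of_distTriang hV
    simp only [Triangle.mk_obj₁, Triangle.mk_obj₂, Triangle.mk_obj₃, K0.of_iso e,
      K0.of_shift_one] at this
    rw [SetLike.mem_coe, AddMonoidHom.mem_ker, map_sub, map_add, FreeAbelianGroup.lift_apply_of,
      FreeAbelianGroup.lift_apply_of, FreeAbelianGroup.lift_apply_of, sub_eq_zero, ← neg_inj, this]
    abel
  refine ⟨QuotientAddGroup.lift (k0Relations D) _ hrel, ⟨τ, hτ, fun X => ?_⟩, fun θ' hθ' => ?_⟩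
  · exact FreeAbelianGroup.lift_apply_of _ _
  · refine K0.end_ext fun X => ?_
    rw [hθ'.map_of (hτ.isSerreDual X), K0.of_shift_one, neg_neg]
    exact (FreeAbelianGroup.lift_apply_of _ _).symm

end AuslanderReiten

section BoundedDerived

open DerivedCategory CategoryTheory.Triangulated

variable {A : Type*} [Category A] [Abelian A] [HasDerivedCategory.{w} A]

/-! ### Generalities on bounded derived categories -/

instance (k : Type*) [Field k] [Linear k A] (n : ℤ) :
    (shiftFunctor (Bounded A) n).Linear k where
  map_smul {X Y} f r := by
    apply Bounded.ι.map_injective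
    have h (g : X ⟶ Y) : Bounded.ι.map (g⟦n⟧') = (Bounded.ι.commShiftIso n).hom.app X ≫
        (Bounded.ι.map g)⟦n⟧' ≫ (Bounded.ι.commShiftIso n).inv.app Y := by
      rw [Functor.commShiftIso_inv_naturality, Iso.hom_inv_id_app_assoc]
    rw [Bounded.ι.map_smul, h, h, Bounded.ι.map_smul, Functor.map_smul, Linear.smul_comp,
      Linear.comp_smul]

theorem bounded_singleFunctor_obj (M : A) :
    TStructure.t.bounded ((singleFunctor A 0).obj M) :=
  ⟨⟨0, inferInstance⟩, ⟨0, inferInstance⟩⟩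

/-- The embedding of an abelian category in its bounded derived category. -/
noncomputable def single (A : Type*) [Category A] [Abelian A] [HasDerivedCategory.{w} A] :
    A ⥤ Bounded A :=
  ObjectProperty.lift _ (singleFunctor A 0) bounded_singleFunctor_obj

instance : (single A).Full := by unfold single; infer_instance

instance : (single A).Faithful := by unfold single; infer_instance

instance (k : Type*) [Field k] [Linear k A] : (single A).Linear k where
  map_smul f r := Bounded.ι.map_injective ((singleFunctor A 0).map_smul r f)

instance : (single A).Additive where
  map_add {_ _ f g} := Bounded.ι.map_injective ((singleFunctor A 0).map_add (f := f) (g := g))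

theorem exists_single_distTriang {S : ShortComplex A} (hS : S.ShortExact) :
    ∃ δ, Triangle.mk ((single A).map S.f) ((single A).map S.g) δ ∈ distTriang (Bounded A) := by
  let δ : (single A).obj S.X₃ ⟶ ((single A).obj S.X₁)⟦(1 : ℤ)⟧ :=
    (Bounded.ι (C := A)).preimage (hS.singleδ ≫
      ((Bounded.ι (C := A)).commShiftIso (1 : ℤ)).inv.app ((single A).obj S.X₁))
  refine ⟨δ, ?_⟩
  have hδ : Bounded.ι.map δ ≫ (Bounded.ι.commShiftIso (1 : ℤ)).hom.app ((single A).obj S.X₁) =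
      hS.singleδ := by
    rw [Functor.map_preimage]
    exact (Category.assoc _ _ _).trans ((congrArg _ (Iso.inv_hom_id_app _ _)).trans
      (Category.comp_id _))
  have : Bounded.ι.mapTriangle.obj
      (Triangle.mk ((single A).map S.f) ((single A).map S.g) δ) = hS.singleTriangle :=
    congrArg (Triangle.mk ((singleFunctor A 0).map S.f) ((singleFunctor A 0).map S.g)) hδ
  exact (Set.mem_preimage).2 (this ▸ hS.singleTriangle_distinguished)

theorem nonempty_shift_single_iso (M : A) (n : ℤ) :
    Nonempty (Bounded.ι.obj (((single A).obj M)⟦n⟧) ≅ (singleFunctor A (-n)).obj M) :=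
  ⟨(Bounded.ι.commShiftIso n).app ((single A).obj M) ≪≫
    ((singleFunctors A).shiftIso n (-n) 0 (by lia)).app M⟩

/-- A triangulated subcategory which contains the abelian category is everything. -/
theorem bounded_induction (Q : ObjectProperty (Bounded A)) [Q.IsClosedUnderIsomorphisms]
    [Q.IsTriangulated] (h : ∀ M, Q ((single A).obj M)) (X : Bounded A) : Q X := by
  let t : TStructure (Bounded A) := TStructure.t.onBounded
  have key₀ (X : Bounded A) (a : ℤ) (h₁ : t.IsGE X a) (h₂ : t.IsLE X a) : Q X := by
    have h₁ : IsGE X.obj a := ⟨h₁.1⟩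
    have h₂ : IsLE X.obj a := ⟨h₂.1⟩
    obtain ⟨M, ⟨e⟩⟩ := exists_iso_singleFunctor_obj_of_isGE_of_isLE X.obj a
    obtain ⟨e'⟩ := nonempty_shift_single_iso M (-a)
    rw [neg_neg] at e'
    exact Q.prop_of_iso (Bounded.ι.preimageIso (e' ≪≫ e.symm)) (Q.le_shift (-a) _ (h M))
  -- Induction on the amplitude, splitting off the top cohomology by truncation.
  have key (d : ℕ) : ∀ (X : Bounded A) (a : ℤ), t.IsGE X a → t.IsLE X (a + d) → Q X := by
    induction d with
    | zero => exact fun X a h₁ h₂ => key₀ X a h₁ (by simpa using h₂)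
    | succ d ih =>
      intro X a h₁ h₂
      have h₂ : t.IsLE X (a + d + 1) := by rwa [add_assoc]
      exact Q.ext_of_isTriangulatedClosed₂ _
        (t.triangleLEGE_distinguished (a + d) (a + d + 1) rfl X)
        (ih _ a (inferInstanceAs (t.IsGE ((t.truncLE (a + d)).obj X) a))
          (inferInstanceAs (t.IsLE ((t.truncLE (a + d)).obj X) (a + d))))
        (key₀ _ (a + d + 1) (inferInstanceAs (t.IsGE ((t.truncGE (a + d + 1)).obj X) _))
          (inferInstanceAs (t.IsLE ((t.truncGE (a + d + 1)).obj X) _)))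
  obtain ⟨a, ha⟩ := X.2.1
  obtain ⟨b, hb⟩ := X.2.2
  refine key (b - a).toNat X a ⟨ha.1⟩ ?_
  have hb : t.IsLE X b := ⟨hb.1⟩
  exact t.isLE_of_le X b _ (by lia)

/-- The object `M⟦i⟧` lies in degree `-i`. For `i < 0` the t-structure forces vanishing; for `i > 0`
projectivity does. -/
theorem shift_projective_eq_zero {P : A} [Projective P] {M : A} {i : ℤ} (hi : i ≠ 0)
    (f : (single A).obj P ⟶ ((single A).obj M)⟦i⟧) : f = 0 := by
  obtain ⟨e⟩ := nonempty_shift_single_iso M i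
  apply Bounded.ι.map_injective
  rw [← cancel_mono e.hom, Functor.map_zero, zero_comp]
  rcases hi.lt_or_gt with hi | hi
  · exact TStructure.t.zero_of_isLE_of_isGE (X := (singleFunctor A 0).obj P) _ 0 (-i) (by lia)
      inferInstance inferInstance
  · exact from_singleFunctor_obj_eq_zero_of_projective
      (L := (CochainComplex.singleFunctor A (-i)).obj M) _ (-i) (by lia)

theorem shift_injective_eq_zero {I : A} [Injective I] {M : A} {i : ℤ} (hi : i ≠ 0)
    (f : ((single A).obj M)⟦i⟧ ⟶ (single A).obj I) : f = 0 := by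
  obtain ⟨e⟩ := nonempty_shift_single_iso M i
  apply Bounded.ι.map_injective
  rw [← cancel_epi e.inv, Functor.map_zero, comp_zero]
  rcases hi.lt_or_gt with hi | hi
  · exact to_singleFunctor_obj_eq_zero_of_injective
      (K := (CochainComplex.singleFunctor A (-i)).obj M) _ (-i) (by lia)
  · exact TStructure.t.zero_of_isLE_of_isGE (Y := (singleFunctor A 0).obj I) _ (-i) 0 (by lia)
      inferInstance inferInstance

end BoundedDerived

section PosetModules

variable {k : Type u} [Field k] {P : Type} [PartialOrder P]

/-! ### Indecomposable projective and injective modules over a poset -/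

variable (k) in
/-- The projective module `P_v`: the module freely generated by an element at `v`. -/
noncomputable def projMod (v : P) : PosetMod k P where
  obj w := FGModuleCat.of k ((v ⟶ w) →₀ k)
  map f := FGModuleCat.ofHom (Finsupp.lmapDomain k k (· ≫ f))
  map_id _ := FGModuleCat.hom_ext (Finsupp.lhom_ext fun x r =>
    Finsupp.mapDomain_single.trans (congrArg (Finsupp.single · r) (Category.comp_id x)))
  map_comp f g := FGModuleCat.hom_ext (Finsupp.lhom_ext fun x r => by
    change Finsupp.mapDomain (· ≫ f ≫ g) (Finsupp.single x r) =
      Finsupp.mapDomain (· ≫ g) (Finsupp.mapDomain (· ≫ f) (Finsupp.single x r))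
    rw [Finsupp.mapDomain_single, Finsupp.mapDomain_single, Finsupp.mapDomain_single,
      Category.assoc])

variable (k) in
/-- The injective module `I_v`: the module cofreely cogenerated by a linear form at `v`. -/
noncomputable def injMod (v : P) : PosetMod k P where
  obj w := FGModuleCat.of k ((w ⟶ v) → k)
  map f := FGModuleCat.ofHom (LinearMap.funLeft k k (f ≫ ·))
  map_id _ := FGModuleCat.hom_ext (LinearMap.ext fun x => funext fun y =>
    congrArg x (Category.id_comp y))
  map_comp f g := FGModuleCat.hom_ext (LinearMap.ext fun x => funext fun y =>
    congrArg x (Category.assoc f g y))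

/-- The action of a morphism of a poset on a module. -/
abbrev mapLin (M : PosetMod k P) {v w : P} (f : v ⟶ w) : M.obj v →ₗ[k] M.obj w :=
  (M.map f).hom.hom

theorem mapLin_comp (M : PosetMod k P) {v w z : P} (f : v ⟶ w) (g : w ⟶ z) (m : M.obj v) :
    mapLin M (f ≫ g) m = mapLin M g (mapLin M f m) :=
  LinearMap.congr_fun (congrArg (fun g => g.hom.hom) (M.map_comp f g)) m

theorem mapLin_id (M : PosetMod k P) (v : P) (m : M.obj v) : mapLin M (𝟙 v) m = m :=
  LinearMap.congr_fun (congrArg (fun g => g.hom.hom) (M.map_id v)) m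

/-- The components of a morphism of modules over a poset. -/
abbrev appLin {M N : PosetMod k P} (φ : M ⟶ N) (v : P) : M.obj v →ₗ[k] N.obj v :=
  (φ.app v).hom.hom

theorem appLin_mapLin {M N : PosetMod k P} (φ : M ⟶ N) {v w : P} (f : v ⟶ w) (m : M.obj v) :
    appLin φ w (mapLin M f m) = mapLin N f (appLin φ v m) :=
  LinearMap.congr_fun (congrArg (fun g => g.hom.hom) (φ.naturality f)) m

theorem posetMod_hom_ext {M N : PosetMod k P} {φ ψ : M ⟶ N}
    (h : ∀ v m, appLin φ v m = appLin ψ v m) :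
    φ = ψ := by
  ext v : 2
  exact FGModuleCat.hom_ext (LinearMap.ext (h v))

/-- The morphism from `P_v` corresponding to an element. -/
noncomputable def projHom {M : PosetMod k P} {v : P} (m : M.obj v) : projMod k v ⟶ M where
  app w := FGModuleCat.ofHom (Finsupp.linearCombination k fun f : v ⟶ w => mapLin M f m)
  naturality w w' f := FGModuleCat.hom_ext (Finsupp.lhom_ext fun x r => by
    change Finsupp.linearCombination k (fun f : v ⟶ w' => mapLin M f m)
      (Finsupp.mapDomain (· ≫ f) (Finsupp.single x r)) =
      mapLin M f (Finsupp.linearCombination k (fun f : v ⟶ w => mapLin M f m) (Finsupp.single x r))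
    rw [Finsupp.mapDomain_single, Finsupp.linearCombination_single,
      Finsupp.linearCombination_single, map_smul, mapLin_comp])

/-- The morphism to `I_v` corresponding to a linear form. -/
noncomputable def injHom {M : PosetMod k P} {v : P} (l : Module.Dual k (M.obj v)) :
    M ⟶ injMod k v where
  app w := FGModuleCat.ofHom (LinearMap.pi fun f : w ⟶ v => l ∘ₗ mapLin M f)
  naturality _ _ f := FGModuleCat.hom_ext (LinearMap.ext fun x => funext fun y =>
    congrArg l (mapLin_comp M f y x).symm)

variable (k) in
/-- The generator of `P_v`. -/
noncomputable def projGen (v : P) : (projMod k v).obj v := Finsupp.single (𝟙 v) (1 : k)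

variable (k) in
/-- The cogenerator of `I_v`. -/
noncomputable def injCogen (v : P) : Module.Dual k ((injMod k v).obj v) :=
  LinearMap.proj (R := k) (φ := fun _ : v ⟶ v => k) (𝟙 v)

theorem appLin_projHom_single {M : PosetMod k P} {v w : P} (m : M.obj v) (f : v ⟶ w) (r : k) :
    appLin (projHom m) w (Finsupp.single f r : (v ⟶ w) →₀ k) = r • mapLin M f m :=
  Finsupp.linearCombination_single k r f

theorem appLin_projHom_gen {M : PosetMod k P} {v : P} (m : M.obj v) :
    appLin (projHom m) v (projGen k v) = m :=
  (appLin_projHom_single m (𝟙 v) 1).trans (by rw [one_smul, mapLin_id])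

theorem projMod_single {v w : P} (f : v ⟶ w) (r : k) :
    (Finsupp.single f r : (v ⟶ w) →₀ k) = r • mapLin (projMod k v) f (projGen k v) := by
  refine Eq.trans ?_ (congrArg (r • ·) (Finsupp.mapDomain_single (f := (· ≫ f))).symm)
  change _ = r • (Finsupp.single (𝟙 v ≫ f) 1 : (v ⟶ w) →₀ k)
  rw [Finsupp.smul_single, smul_eq_mul, mul_one, Category.id_comp]

/-- Yoneda: every element of `P_v` is obtained from the generator by the structure maps and
linearity. -/
theorem projHom_eq {M : PosetMod k P} {v : P} (φ : projMod k v ⟶ M) :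
    projHom (appLin φ v (projGen k v)) = φ := by
  ext w : 2
  refine FGModuleCat.hom_ext (Finsupp.lhom_ext fun f r => ?_)
  refine (appLin_projHom_single _ f r).trans ?_
  refine Eq.trans ?_ (congrArg (appLin φ w) (projMod_single f r)).symm
  refine Eq.trans ?_ ((appLin φ w).map_smul r _).symm
  rw [appLin_mapLin]

theorem cogen_injHom {M : PosetMod k P} {v : P} (l : Module.Dual k (M.obj v)) (m : M.obj v) :
    injCogen k v (appLin (injHom l) v m) = l m :=
  congrArg l (mapLin_id M v m)

theorem injHom_eq {M : PosetMod k P} {v : P} (φ : M ⟶ injMod k v) :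
    injHom (injCogen k v ∘ₗ appLin φ v) = φ := by
  refine posetMod_hom_ext fun w m => funext fun f => ?_
  refine (congrArg (injCogen k v) (appLin_mapLin φ f m)).trans ?_
  exact congrArg (appLin φ w m : (w ⟶ v) → k) (Category.comp_id f)

theorem appLin_surjective {M N : PosetMod k P} (φ : M ⟶ N) [Epi φ] (v : P) :
    Function.Surjective (appLin φ v) := by
  have : Epi ((forget₂ (FGModuleCat k) (ModuleCat k)).map (φ.app v)) := inferInstance
  exact (ModuleCat.epi_iff_surjective _).1 this

theorem appLin_injective {M N : PosetMod k P} (φ : M ⟶ N) [Mono φ] (v : P) :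
    Function.Injective (appLin φ v) := by
  have : Mono ((forget₂ (FGModuleCat k) (ModuleCat k)).map (φ.app v)) := inferInstance
  exact (ModuleCat.mono_iff_injective _).1 this

instance (v : P) : Projective (projMod k v) where
  factors {M N} φ e _ := by
    obtain ⟨m, hm⟩ := appLin_surjective e v (appLin φ v (projGen k v))
    refine ⟨projHom m, ?_⟩
    rw [← projHom_eq φ, ← projHom_eq (projHom m ≫ e)]
    congr 1
    exact (congrArg _ (appLin_projHom_gen m)).trans hm

instance (v : P) : Injective (injMod k v) where
  factors {M N} φ i _ := by
    obtain ⟨l, hl⟩ := LinearMap.exists_leftInverse_of_injective (appLin i v)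
      (LinearMap.ker_eq_bot.2 (appLin_injective i v))
    refine ⟨injHom ((injCogen k v ∘ₗ appLin φ v) ∘ₗ l), ?_⟩
    refine (injHom_eq (i ≫ _)).symm.trans ((congrArg _ ?_).trans (injHom_eq φ))
    ext m
    have := LinearMap.congr_fun hl m
    exact (cogen_injHom ((injCogen k v ∘ₗ appLin φ v) ∘ₗ l) (appLin i v m)).trans
      (congrArg (injCogen k v ∘ₗ appLin φ v) this)

theorem projHom_add {v : P} {M : PosetMod k P} (m m' : M.obj v) :
    projHom (m + m') = projHom m + projHom m' := by
  rw [← projHom_eq (projHom m + projHom m')]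
  exact congrArg projHom
    (congrArg₂ (· + ·) (appLin_projHom_gen m) (appLin_projHom_gen m')).symm

theorem projHom_smul {v : P} {M : PosetMod k P} (r : k) (m : M.obj v) :
    projHom (r • m) = r • projHom m := by
  rw [← projHom_eq (r • projHom m)]
  exact congrArg projHom (congrArg (r • ·) (appLin_projHom_gen m)).symm

end PosetModules

/-- The two short exact sequences through the image are the ones on which the dévissage arguments
run. -/
theorem exists_image_factorization {A : Type*} [Category A] [Abelian A] {X Y : A} (φ : X ⟶ Y) :
    ∃ (I : A) (p : X ⟶ I) (i : I ⟶ Y) (h₁ : kernel.ι φ ≫ p = 0) (h₂ : i ≫ cokernel.π φ = 0),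
      p ≫ i = φ ∧ (ShortComplex.mk _ _ h₁).ShortExact ∧ (ShortComplex.mk _ _ h₂).ShortExact := by
  have h₁ : kernel.ι φ ≫ Abelian.factorThruImage φ = 0 := by
    rw [← cancel_mono (Abelian.image.ι φ)]
    simp
  have h₂ : Abelian.image.ι φ ≫ cokernel.π φ = 0 := kernel.condition _
  refine ⟨_, Abelian.factorThruImage φ, Abelian.image.ι φ, h₁, h₂, by simp, ⟨?_⟩, ⟨?_⟩⟩
  · let f : ShortComplex.mk _ _ h₁ ⟶ ShortComplex.mk _ _ (kernel.condition φ) :=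
      { τ₁ := 𝟙 _, τ₂ := 𝟙 _, τ₃ := Abelian.image.ι φ }
    have : IsIso f.τ₂ := inferInstanceAs (IsIso (𝟙 X))
    have : Epi f.τ₁ := inferInstanceAs (Epi (𝟙 (kernel φ)))
    have : Mono f.τ₃ := inferInstanceAs (Mono (Abelian.image.ι φ))
    exact (ShortComplex.exact_iff_of_epi_of_isIso_of_mono f).2 (ShortComplex.exact_kernel φ)
  · exact ShortComplex.exact_kernel _

section PosetModules

variable {k : Type u} [Field k] {P : Type} [PartialOrder P]

/-! ### Dévissage of modules over a poset -/

theorem isZero_of_subsingleton {M : PosetMod k P} (h : ∀ v, Subsingleton (M.obj v)) : IsZero M := by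
  rw [IsZero.iff_id_eq_zero]
  exact posetMod_hom_ext fun v m => (h v).elim _ _

/-- The dimension vector of a module. -/
noncomputable def dimVec (M : PosetMod k P) (v : P) : ℕ := Module.finrank k (M.obj v)

theorem shortExact_appLin {S : ShortComplex (PosetMod k P)} (hS : S.ShortExact) (v : P) :
    Function.Injective (appLin S.f v) ∧ (appLin S.f v).range = (appLin S.g v).ker ∧
      Function.Surjective (appLin S.g v) := by
  have := hS.mono_f
  have := hS.epi_g
  refine ⟨appLin_injective S.f v, ?_, appLin_surjective S.g v⟩
  have h := hS.exact.map ((evaluation P (FGModuleCat k)).obj v ⋙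
    forget₂ (FGModuleCat k) (ModuleCat k))
  exact h.moduleCat_range_eq_ker

theorem dimVec_of_shortExact {S : ShortComplex (PosetMod k P)} (hS : S.ShortExact) (v : P) :
    dimVec S.X₂ v = dimVec S.X₁ v + dimVec S.X₃ v := by
  obtain ⟨hf, h, hg⟩ := shortExact_appLin hS v
  have h₁ := LinearMap.finrank_range_of_inj hf
  have h₂ := (appLin S.g v).finrank_range_add_finrank_ker
  rw [← h, h₁, LinearMap.range_eq_top.2 hg, finrank_top] at h₂
  unfold dimVec
  lia

theorem dimVec_pos_iff (M : PosetMod k P) (v : P) : 0 < dimVec M v ↔ Nontrivial (M.obj v) :=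
  Module.finrank_pos_iff

open scoped Classical in
theorem dimVec_projMod (v w : P) : dimVec (projMod k v) w = if v ≤ w then 1 else 0 := by
  have := Fintype.ofFinite (v ⟶ w)
  have h : dimVec (projMod k v) w = Fintype.card (v ⟶ w) := Module.finrank_finsupp_self k
  rw [h]
  split_ifs with hvw
  · exact Fintype.card_eq_one_iff.2 ⟨homOfLE hvw, fun _ => Subsingleton.elim _ _⟩
  · exact Fintype.card_eq_zero_iff.2 ⟨fun f => hvw (leOfHom f)⟩

open scoped Classical in
theorem dimVec_injMod (v w : P) : dimVec (injMod k v) w = if w ≤ v then 1 else 0 := by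
  have := Fintype.ofFinite (w ⟶ v)
  have h : dimVec (injMod k v) w = Fintype.card (w ⟶ v) := Module.finrank_fintype_fun_eq_card k
  rw [h]
  split_ifs with hvw
  · exact Fintype.card_eq_one_iff.2 ⟨homOfLE hvw, fun _ => Subsingleton.elim _ _⟩
  · exact Fintype.card_eq_zero_iff.2 ⟨fun f => hvw (leOfHom f)⟩

variable (k) in
theorem upVec_eq_dimVec (v : P) : upVec v = fun w => (dimVec (projMod k v) w : ℤ) := by
  ext w
  simp [upVec, dimVec_projMod]

variable (k) in
theorem downVec_eq_dimVec (v : P) : downVec v = fun w => (dimVec (injMod k v) w : ℤ) := by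
  ext w
  simp [downVec, dimVec_injMod]

variable [Fintype P]

theorem sum_dimVec_lt {M N : PosetMod k P} (h : ∀ v, dimVec M v ≤ dimVec N v) {v : P}
    (hv : dimVec M v < dimVec N v) : ∑ v, dimVec M v < ∑ v, dimVec N v :=
  Finset.sum_lt_sum (fun v _ => h v) ⟨v, Finset.mem_univ v, hv⟩

/-- A nonzero element of `M_v` gives a map `P_v ⟶ M` with image `I` nonzero at `v`. As `P_v` has
dimension one at `v`, the kernel lives strictly above `v`, where `hR` applies; the cokernel has
smaller total dimension and its support is still in `R`. -/
theorem devissage_proj_aux {Q : PosetMod k P → Prop}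
    (h₀ : ∀ M, IsZero M → Q M)
    (h₂ : ∀ S : ShortComplex (PosetMod k P), S.ShortExact → Q S.X₁ → Q S.X₃ → Q S.X₂)
    (h₃ : ∀ S : ShortComplex (PosetMod k P), S.ShortExact → Q S.X₁ → Q S.X₂ → Q S.X₃)
    (hP : ∀ v, Q (projMod k v)) (R : P → Prop)
    (hR : ∀ u, R u → ∀ M, (∀ w, 0 < dimVec M w → u < w) → Q M)
    (M : PosetMod k P) (hM : ∀ w, 0 < dimVec M w → R w) : Q M := by
  induction hd : ∑ v, dimVec M v using Nat.strong_induction_on generalizing M with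
  | _ d ih =>
  subst hd
  by_cases hz : ∃ v, 0 < dimVec M v
  · obtain ⟨v, hv⟩ := hz
    have := (dimVec_pos_iff M v).1 hv
    obtain ⟨m, hm⟩ := exists_ne (0 : M.obj v)
    obtain ⟨I, p, i, w₁, w₂, hφ, hS₁, hS₂⟩ := exists_image_factorization (projHom m)
    have d₁ := dimVec_of_shortExact hS₁
    have d₂ := dimVec_of_shortExact hS₂
    dsimp at d₁ d₂
    have hI : 0 < dimVec I v := by
      rw [dimVec_pos_iff]
      refine nontrivial_of_ne (appLin p v (projGen k v)) 0 fun h => hm ?_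
      have : appLin (p ≫ i) v (projGen k v) = appLin i v (appLin p v (projGen k v)) := rfl
      rw [h, map_zero, hφ, appLin_projHom_gen] at this
      exact this
    refine h₂ _ hS₂ (h₃ _ hS₁ (hR v (hM v hv) _ fun w hw => ?_) (hP v))
      (ih _ (sum_dimVec_lt (v := v) ?_ ?_) _ ?_ rfl)
    · have := d₁ w
      rw [dimVec_projMod] at this
      split_ifs at this with hvw
      · refine lt_of_le_of_ne hvw ?_
        rintro rfl
        lia
      · lia
    · intro w; have := d₂ w; lia
    · have := d₂ v; lia
    · intro w hw
      have := d₂ w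
      exact hM w (by lia)
  · refine h₀ M (isZero_of_subsingleton fun v => ?_)
    rw [← not_nontrivial_iff_subsingleton, ← dimVec_pos_iff]
    exact fun h => hz ⟨v, h⟩

/-- Descending induction on `u` for modules supported strictly above `u`; the last use takes no
restriction on the support. -/
theorem devissage_proj {Q : PosetMod k P → Prop}
    (h₀ : ∀ M, IsZero M → Q M)
    (h₂ : ∀ S : ShortComplex (PosetMod k P), S.ShortExact → Q S.X₁ → Q S.X₃ → Q S.X₂)
    (h₃ : ∀ S : ShortComplex (PosetMod k P), S.ShortExact → Q S.X₁ → Q S.X₂ → Q S.X₃)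
    (hP : ∀ v, Q (projMod k v)) (M : PosetMod k P) : Q M := by
  refine devissage_proj_aux h₀ h₂ h₃ hP (fun _ => True) (fun u _ => ?_) M fun _ _ => trivial
  induction u using (wellFounded_gt (α := P)).induction with
  | _ u ih => exact devissage_proj_aux h₀ h₂ h₃ hP _ ih

theorem devissage_inj_aux {Q : PosetMod k P → Prop}
    (h₀ : ∀ M, IsZero M → Q M)
    (h₁ : ∀ S : ShortComplex (PosetMod k P), S.ShortExact → Q S.X₂ → Q S.X₃ → Q S.X₁)
    (h₂ : ∀ S : ShortComplex (PosetMod k P), S.ShortExact → Q S.X₁ → Q S.X₃ → Q S.X₂)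
    (hI : ∀ v, Q (injMod k v)) (R : P → Prop)
    (hR : ∀ u, R u → ∀ M, (∀ w, 0 < dimVec M w → w < u) → Q M)
    (M : PosetMod k P) (hM : ∀ w, 0 < dimVec M w → R w) : Q M := by
  induction hd : ∑ v, dimVec M v using Nat.strong_induction_on generalizing M with
  | _ d ih =>
  subst hd
  by_cases hz : ∃ v, 0 < dimVec M v
  · obtain ⟨v, hv⟩ := hz
    have := (dimVec_pos_iff M v).1 hv
    obtain ⟨l, hl⟩ := exists_ne (0 : Module.Dual k (M.obj v))
    obtain ⟨m, hm⟩ := DFunLike.ne_iff.1 hl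
    obtain ⟨I, p, i, w₁, w₂, hφ, hS₁, hS₂⟩ := exists_image_factorization (injHom l)
    have d₁ := dimVec_of_shortExact hS₁
    have d₂ := dimVec_of_shortExact hS₂
    dsimp at d₁ d₂
    have hI' : 0 < dimVec I v := by
      rw [dimVec_pos_iff]
      refine nontrivial_of_ne (appLin p v m) 0 fun h => hm ?_
      have : appLin (p ≫ i) v m = appLin i v (appLin p v m) := rfl
      rw [h, map_zero, hφ] at this
      exact (cogen_injHom l m).symm.trans ((congrArg _ this).trans (map_zero _))
    refine h₂ _ hS₁ (ih _ (sum_dimVec_lt (v := v) ?_ ?_) _ ?_ rfl)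
      (h₁ _ hS₂ (hI v) (hR v (hM v hv) _ fun w hw => ?_))
    · intro w; have := d₁ w; lia
    · have := d₁ v; lia
    · intro w hw
      have := d₁ w
      exact hM w (by lia)
    · have := d₂ w
      rw [dimVec_injMod] at this
      split_ifs at this with hvw
      · refine lt_of_le_of_ne hvw ?_
        rintro rfl
        lia
      · lia
  · refine h₀ M (isZero_of_subsingleton fun v => ?_)
    rw [← not_nontrivial_iff_subsingleton, ← dimVec_pos_iff]
    exact fun h => hz ⟨v, h⟩

theorem devissage_inj {Q : PosetMod k P → Prop}
    (h₀ : ∀ M, IsZero M → Q M)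
    (h₁ : ∀ S : ShortComplex (PosetMod k P), S.ShortExact → Q S.X₂ → Q S.X₃ → Q S.X₁)
    (h₂ : ∀ S : ShortComplex (PosetMod k P), S.ShortExact → Q S.X₁ → Q S.X₃ → Q S.X₂)
    (hI : ∀ v, Q (injMod k v)) (M : PosetMod k P) : Q M := by
  refine devissage_inj_aux h₀ h₁ h₂ hI (fun _ => True) (fun u _ => ?_) M fun _ _ => trivial
  induction u using (wellFounded_lt (α := P)).induction with
  | _ u ih => exact devissage_inj_aux h₀ h₁ h₂ hI _ ih

end PosetModules

/-! ### Triangulated closure arguments -/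

section Triangulated

variable {D : Type*} [Category D] [HasZeroObject D] [Preadditive D] [HasShift D ℤ]
  [∀ n : ℤ, (shiftFunctor D n).Additive] [Pretriangulated D]

/-- The objects all of whose shifts satisfy a given property. -/
def shiftCore (R : ObjectProperty D) : ObjectProperty D := fun Y => ∀ i : ℤ, R (Y⟦i⟧)

instance (R : ObjectProperty D) [R.IsClosedUnderIsomorphisms] :
    (shiftCore R).IsClosedUnderIsomorphisms where
  of_iso e h i := R.prop_of_iso ((shiftFunctor D i).mapIso e) (h i)

/-- Asking for `R` on all shifts at once supplies the two outer neighbours that a five-lemma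
argument needs. -/
theorem isTriangulated_shiftCore (R : ObjectProperty D) [R.IsClosedUnderIsomorphisms]
    (h₀ : ∀ Z, IsZero Z → R Z)
    (h : ∀ T ∈ distTriang D, R T.obj₁ → R (T.obj₁⟦(1 : ℤ)⟧) → R T.obj₃ →
      R (T.obj₃⟦(-1 : ℤ)⟧) → R T.obj₂) : (shiftCore R).IsTriangulated where
  exists_zero := ⟨_, isZero_zero D, fun i =>
    h₀ _ ((shiftFunctor D i).map_isZero (isZero_zero D))⟩
  isStableUnderShiftBy n := ⟨fun Y hY i =>
    R.prop_of_iso ((shiftFunctorAdd D n i).app Y) (hY (n + i))⟩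
  ext₂' T hT h₁ h₃ := ObjectProperty.le_isoClosure _ _ fun i =>
    h _ (Triangle.shift_distinguished T hT i) (h₁ i)
      (R.prop_of_iso ((shiftFunctorAdd D i 1).app T.obj₁) (h₁ (i + 1))) (h₃ i)
      (R.prop_of_iso ((shiftFunctorAdd D i (-1)).app T.obj₃) (h₃ (i + (-1))))

/-! ### Finite-dimensionality and existence of Serre duals as triangulated properties. -/

variable {k : Type*} [Field k] [Linear k D]

theorem finite_of_exact {U V W : Type*} [AddCommGroup U] [Module k U] [AddCommGroup V]
    [Module k V] [AddCommGroup W] [Module k W] [FiniteDimensional k U] [FiniteDimensional k W]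
    (f : U →ₗ[k] V) (g : V →ₗ[k] W) (h : ∀ v, g v = 0 → ∃ u, f u = v) :
    FiniteDimensional k V := by
  have h' : g.ker ≤ f.range := fun v hv => h v hv
  have : FiniteDimensional k g.ker := Submodule.finiteDimensional_of_le h'
  have : FiniteDimensional k (V ⧸ g.ker) := g.quotKerEquivRange.symm.finiteDimensional
  exact Module.Finite.of_submodule_quotient g.ker

theorem finiteDimensional_hom_of_distTriang {T : Triangle D} (hT : T ∈ distTriang D) (X : D)
    [FiniteDimensional k (X ⟶ T.obj₁)] [FiniteDimensional k (X ⟶ T.obj₃)] :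
    FiniteDimensional k (X ⟶ T.obj₂) :=
  finite_of_exact (Linear.rightComp k X T.mor₁) (Linear.rightComp k X T.mor₂) fun f hf => by
    obtain ⟨g, hg⟩ := T.coyoneda_exact₂ hT f hf
    exact ⟨g, hg.symm⟩

theorem finiteDimensional_hom_of_distTriang' {T : Triangle D} (hT : T ∈ distTriang D) (Y : D)
    [FiniteDimensional k (T.obj₁ ⟶ Y)] [FiniteDimensional k (T.obj₃ ⟶ Y)] :
    FiniteDimensional k (T.obj₂ ⟶ Y) :=
  finite_of_exact (Linear.leftComp k Y T.mor₂) (Linear.leftComp k Y T.mor₁) fun f hf => by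
    obtain ⟨g, hg⟩ := T.yoneda_exact₂ hT f hf
    exact ⟨g, hg.symm⟩

variable (k) in
/-- The objects `Y` for which `Hom(X, Y)` is finite-dimensional. -/
def finiteHomFrom (X : D) : ObjectProperty D := fun Y => FiniteDimensional k (X ⟶ Y)

instance (X : D) : (finiteHomFrom k X).IsClosedUnderIsomorphisms where
  of_iso e h := by
    have : FiniteDimensional k (X ⟶ _) := h
    exact Module.Finite.of_injective (Linear.rightComp k X e.inv)
      fun f g h => (cancel_mono e.inv).1 h

instance (X : D) : (shiftCore (finiteHomFrom k X)).IsTriangulated :=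
  isTriangulated_shiftCore _
    (fun Z hZ => by
      have : Subsingleton (X ⟶ Z) := ⟨hZ.eq_of_tgt⟩
      exact Module.Finite.of_finite)
    (fun T hT h₁ _ h₃ _ => by
      have : FiniteDimensional k (X ⟶ T.obj₁) := h₁
      have : FiniteDimensional k (X ⟶ T.obj₃) := h₃
      exact finiteDimensional_hom_of_distTriang hT X)

variable (k D) in
/-- The objects `X` such that `Hom(X, Y)` is finite-dimensional for all `Y`. -/
def finiteHom : ObjectProperty D := fun X => ∀ Y, FiniteDimensional k (X ⟶ Y)

instance : (finiteHom D k).IsClosedUnderIsomorphisms where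
  of_iso e h Y := by
    have := h Y
    exact Module.Finite.of_injective (Linear.leftComp k Y e.hom)
      fun f g h => (cancel_epi e.hom).1 h

instance [∀ n : ℤ, (shiftFunctor D n).Linear k] : (finiteHom D k).IsTriangulated where
  exists_zero := ⟨_, isZero_zero D, fun Y => by
    have : Subsingleton ((HasZeroObject.zero' D).zero ⟶ Y) := ⟨(isZero_zero D).eq_of_src⟩
    exact Module.Finite.of_finite⟩
  isStableUnderShiftBy n := ⟨fun X hX Y => by
    let i := (shiftFunctorCompIsoId D n (-n) (by simp)).app X
    have : FiniteDimensional k ((X⟦n⟧)⟦-n⟧ ⟶ Y⟦-n⟧) :=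
      (finiteHom D k).prop_of_iso i.symm hX (Y⟦-n⟧)
    exact Module.Finite.of_injective ((shiftFunctor D (-n)).mapLinearMap k (X := X⟦n⟧) (Y := Y))
      (shiftFunctor D (-n)).map_injective⟩
  ext₂' T hT h₁ h₃ := ObjectProperty.le_isoClosure _ _ fun Y => by
    have := h₁ Y
    have := h₃ Y
    exact finiteDimensional_hom_of_distTriang' hT Y

/-- The objects `Y` for which a linear form on `Hom(X, W)` identifies `Hom(Y, W)` with the dual
of `Hom(X, Y)`. -/
def serreLocus {X W : D} (t : (X ⟶ W) →ₗ[k] k) : ObjectProperty D :=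
  fun Y => Function.Bijective (serreMap t Y)

instance {X W : D} (t : (X ⟶ W) →ₗ[k] k) : (serreLocus t).IsClosedUnderIsomorphisms where
  of_iso {Y Y'} e h := by
    refine ⟨(injective_iff_map_eq_zero _).2 fun g hg => ?_, fun l => ?_⟩
    · rw [← cancel_epi e.hom, comp_zero]
      refine (injective_iff_map_eq_zero _).1 h.1 _ (LinearMap.ext fun f => ?_)
      have := LinearMap.congr_fun hg (f ≫ e.hom)
      simpa using this
    · obtain ⟨g, hg⟩ := h.2 (l ∘ₗ Linear.rightComp k X e.hom)
      refine ⟨e.inv ≫ g, LinearMap.ext fun f => ?_⟩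
      have := LinearMap.congr_fun hg (f ≫ e.inv)
      simpa using this

theorem exists_desuspended_mor₃ {T : Triangle D} (hT : T ∈ distTriang D) :
    ∃ δ : T.obj₃⟦(-1 : ℤ)⟧ ⟶ T.obj₁, δ ≫ T.mor₁ = 0 ∧
      ∀ {Y : D} (g : T.obj₁ ⟶ Y), δ ≫ g = 0 → ∃ g', g = T.mor₁ ≫ g' :=
  have hT' := inv_rot_of_distTriang _ hT
  ⟨T.invRotate.mor₁, comp_distTriang_mor_zero₁₂ _ hT', T.invRotate.yoneda_exact₂ hT'⟩

/-- The five lemma for `serreMap t`: both `Hom(-, W)` and the dual of `Hom(X, -)` turn triangles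
into exact sequences. -/
theorem serreLocus_of_distTriang {X W : D} (t : (X ⟶ W) →ₗ[k] k) {T : Triangle D}
    (hT : T ∈ distTriang D) (h₁ : serreLocus t T.obj₁) (h₁' : serreLocus t (T.obj₁⟦(1 : ℤ)⟧))
    (h₃ : serreLocus t T.obj₃) (h₃' : serreLocus t (T.obj₃⟦(-1 : ℤ)⟧)) :
    serreLocus t T.obj₂ := by
  have inj {Y : D} (h : serreLocus t Y) (g : Y ⟶ W) (hg : ∀ f : X ⟶ Y, t (f ≫ g) = 0) : g = 0 :=
    (injective_iff_map_eq_zero _).1 h.1 g (LinearMap.ext hg)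
  have surj {Y : D} (h : serreLocus t Y) (l : Module.Dual k (X ⟶ Y)) :
      ∃ g : Y ⟶ W, ∀ f : X ⟶ Y, t (f ≫ g) = l f := by
    obtain ⟨g, hg⟩ := h.2 l
    exact ⟨g, LinearMap.congr_fun hg⟩
  refine ⟨(injective_iff_map_eq_zero _).2 fun g hg => ?_, fun l => ?_⟩
  · have hg (f : X ⟶ T.obj₂) : t (f ≫ g) = 0 := LinearMap.congr_fun hg f
    obtain ⟨g', rfl⟩ := T.yoneda_exact₂ hT g (inj h₁ _ fun f => by
      rw [← Category.assoc, hg])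
    obtain ⟨l, hl⟩ := exists_comp_eq_of_ker_le (Linear.rightComp k X T.mor₃)
      (t ∘ₗ Linear.rightComp k X g') (fun f hf => by
        obtain ⟨u, rfl⟩ := T.coyoneda_exact₃ hT f hf
        simpa using hg u)
    obtain ⟨h, hh⟩ := surj h₁' l
    have : g' - T.mor₃ ≫ h = 0 := inj h₃ _ fun f => by
      have := hl f
      rw [Linear.rightComp_apply, ← hh] at this
      simpa [sub_eq_zero] using this.symm
    rw [sub_eq_zero.1 this, ← Category.assoc, comp_distTriang_mor_zero₂₃ _ hT, zero_comp]
  · obtain ⟨g₁, hg₁⟩ := surj h₁ (l ∘ₗ Linear.rightComp k X T.mor₁)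
    obtain ⟨δ, hδ, hδ'⟩ := exists_desuspended_mor₃ hT
    obtain ⟨g₂, hg₂⟩ := hδ' g₁ (inj h₃' _ fun f => by
      have := hg₁ (f ≫ δ)
      rw [LinearMap.comp_apply, Linear.rightComp_apply, Category.assoc, Category.assoc, hδ,
        comp_zero, map_zero] at this
      exact this)
    obtain ⟨l₃, hl₃⟩ := exists_comp_eq_of_ker_le (Linear.rightComp k X T.mor₂)
      (l - t ∘ₗ Linear.rightComp k X g₂) (fun f hf => by
        obtain ⟨u, rfl⟩ := T.coyoneda_exact₂ hT f hf
        have := hg₁ u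
        rw [hg₂, LinearMap.comp_apply, Linear.rightComp_apply] at this
        simp [this])
    obtain ⟨g₃, hg₃⟩ := surj h₃ l₃
    refine ⟨g₂ + T.mor₂ ≫ g₃, LinearMap.ext fun f => ?_⟩
    have := hl₃ f
    rw [Linear.rightComp_apply, ← hg₃] at this
    simp only [Category.assoc, LinearMap.sub_apply, LinearMap.comp_apply,
      Linear.rightComp_apply] at this
    rw [serreMap_apply, Preadditive.comp_add, map_add, this]
    abel

instance {X W : D} (t : (X ⟶ W) →ₗ[k] k) : (shiftCore (serreLocus t)).IsTriangulated :=
  isTriangulated_shiftCore _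
    (fun Z hZ => by
      have : Subsingleton (X ⟶ Z) := ⟨hZ.eq_of_tgt⟩
      have : Subsingleton (Z ⟶ W) := ⟨hZ.eq_of_src⟩
      exact ⟨fun _ _ _ => Subsingleton.elim _ _, fun l => ⟨0, LinearMap.ext fun f => by
        rw [Subsingleton.elim f 0, map_zero, map_zero]⟩⟩)
    (fun _ hT h₁ h₁' h₃ h₃' => serreLocus_of_distTriang t hT h₁ h₁' h₃ h₃')

variable (k D) in
/-- The objects which have a Serre dual. -/
def hasSerreDual : ObjectProperty D := fun X => ∃ W, IsSerreDual k X W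

variable (k D) in
/-- The objects which are Serre duals. -/
def isSomeSerreDual : ObjectProperty D := fun W => ∃ X, IsSerreDual k X W

instance : (hasSerreDual D k).IsClosedUnderIsomorphisms where
  of_iso e := fun ⟨W, h⟩ => ⟨W, h.of_iso e (Iso.refl W)⟩

instance : (isSomeSerreDual D k).IsClosedUnderIsomorphisms where
  of_iso e := fun ⟨X, h⟩ => ⟨X, h.of_iso (Iso.refl X) e⟩

instance [∀ n : ℤ, (shiftFunctor D n).Linear k] : (hasSerreDual D k).IsTriangulated where
  exists_zero := ⟨_, isZero_zero D, _, isSerreDual_of_isZero (isZero_zero D) (isZero_zero D)⟩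
  isStableUnderShiftBy n := ⟨fun _ ⟨_, h⟩ => ⟨_, h.shift n⟩⟩
  ext₂' T hT := fun ⟨_, h₁⟩ ⟨_, h₃⟩ => ObjectProperty.le_isoClosure _ _ (by
    obtain ⟨W, -, -, -, -, h⟩ := exists_distTriang_of_isSerreDual hT h₁ h₃
    exact ⟨W, h⟩)

instance [∀ n : ℤ, (shiftFunctor D n).Linear k] [∀ X Y : D, FiniteDimensional k (X ⟶ Y)] :
    (isSomeSerreDual D k).IsTriangulated where
  exists_zero := ⟨_, isZero_zero D, _, isSerreDual_of_isZero (isZero_zero D) (isZero_zero D)⟩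
  isStableUnderShiftBy n := ⟨fun _ ⟨_, h⟩ => ⟨_, h.shift n⟩⟩
  ext₂' _ hT := fun ⟨_, h₁⟩ ⟨_, h₃⟩ => ObjectProperty.le_isoClosure _ _
    (exists_isSerreDual_of_distTriang hT h₁ h₃)

/-! ### Subgroups of the Grothendieck group -/

theorem K0.of_shift_mem_iff (H : AddSubgroup (K0 D)) (X : D) (n : ℤ) :
    K0.of (X⟦n⟧) ∈ H ↔ K0.of X ∈ H := by
  have step (n : ℤ) : K0.of (X⟦n + 1⟧) ∈ H ↔ K0.of (X⟦n⟧) ∈ H := by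
    rw [K0.of_iso ((shiftFunctorAdd D n 1).app X), Functor.comp_obj, K0.of_shift_one, neg_mem_iff]
  induction n using Int.induction_on with
  | zero => rw [K0.of_iso ((shiftFunctorZero D ℤ).app X)]; rfl
  | succ n ih => exact (step n).trans ih
  | pred n ih => exact ((step (-n - 1)).symm.trans (by rw [sub_add_cancel])).trans ih

/-- The objects whose class is in a given subgroup. -/
def classMem (H : AddSubgroup (K0 D)) : ObjectProperty D := fun X => K0.of X ∈ H

instance (H : AddSubgroup (K0 D)) : (classMem H).IsClosedUnderIsomorphisms where
  of_iso e h := by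
    unfold classMem at h ⊢
    rwa [← K0.of_iso e]

instance (H : AddSubgroup (K0 D)) : (classMem H).IsTriangulated where
  exists_zero := ⟨_, isZero_zero D, by
    unfold classMem
    rw [K0.of_isZero (isZero_zero D)]
    exact zero_mem H⟩
  isStableUnderShiftBy n := ⟨fun X hX => (K0.of_shift_mem_iff H X n).2 hX⟩
  ext₂' T hT h₁ h₃ := ObjectProperty.le_isoClosure _ _ (by
    unfold classMem at *
    rw [K0.of_distTriang hT]
    exact add_mem h₁ h₃)

end Triangulated

section DerivedPoset

open DerivedCategory

variable {k : Type u} [Field k] {P : Type} [PartialOrder P] [HasDerivedCategory.{w} (PosetMod k P)]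

/-! ### The bounded derived category of modules over a finite poset -/

/-- The linear form on `Hom(P_v, I_v)` in the derived category. -/
noncomputable def canonicalForm (v : P) :
    ((single (PosetMod k P)).obj (projMod k v) ⟶
      (single (PosetMod k P)).obj (injMod k v)) →ₗ[k] k :=
  { toFun := fun φ : projMod k v ⟶ injMod k v => injCogen k v (appLin φ v (projGen k v))
    map_add' := fun _ _ => map_add (injCogen k v) _ _
    map_smul' := fun _ _ => map_smul (injCogen k v) _ _ } ∘ₗ
  (LinearEquiv.ofBijective ((single (PosetMod k P)).mapLinearMap k)
    ⟨(single _).map_injective, (single _).map_surjective⟩).symm.toLinearMap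

theorem canonicalForm_map {v : P} (φ : projMod k v ⟶ injMod k v) :
    canonicalForm v ((single (PosetMod k P)).map φ) = injCogen k v (appLin φ v (projGen k v)) := by
  have : (LinearEquiv.ofBijective ((single (PosetMod k P)).mapLinearMap k)
    ⟨(single _).map_injective, (single _).map_surjective⟩).symm
      ((single (PosetMod k P)).map φ) = φ :=
    LinearEquiv.symm_apply_apply (LinearEquiv.ofBijective ((single (PosetMod k P)).mapLinearMap k)
      ⟨(single _).map_injective, (single _).map_surjective⟩) φ
  simp only [canonicalForm, LinearMap.comp_apply, LinearEquiv.coe_coe, this]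
  rfl

theorem canonicalForm_comp {v : P} {M : PosetMod k P} (m : M.obj v) (l : Module.Dual k (M.obj v)) :
    canonicalForm v ((single _).map (projHom m) ≫ (single _).map (injHom l)) = l m := by
  rw [← Functor.map_comp, canonicalForm_map]
  refine Eq.trans ?_ (cogen_injHom l m)
  exact congrArg (fun x => injCogen k v (appLin (injHom l) v x)) (appLin_projHom_gen m)

/-- Elements of a module as morphisms from `P_v` in the derived category. -/
noncomputable def projHomLin (v : P) (M : PosetMod k P) :
    M.obj v →ₗ[k] ((single (PosetMod k P)).obj (projMod k v) ⟶ (single _).obj M) where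
  toFun m := (single _).map (projHom m)
  map_add' m m' := by rw [projHom_add, Functor.map_add]
  map_smul' r m := by rw [projHom_smul, Functor.map_smul, RingHom.id_apply]

theorem projHomLin_surjective (v : P) (M : PosetMod k P) :
    Function.Surjective (projHomLin v M) := by
  intro f
  obtain ⟨g, hg⟩ := (single (PosetMod k P)).map_surjective f
  refine ⟨appLin g v (projGen k v), ?_⟩
  rw [← hg]
  exact congrArg (single (PosetMod k P)).map (projHom_eq g)

/-- Under `Hom(P_v, M) = M_v` and `Hom(M, I_v) = (M_v)^*`, the pairing given by `canonicalForm` is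
evaluation of a linear form at a vector. -/
theorem serreLocus_single (v : P) (M : PosetMod k P) :
    serreLocus (canonicalForm (k := k) v) ((single _).obj M) := by
  refine ⟨(injective_iff_map_eq_zero _).2 fun g hg => ?_, fun L => ?_⟩
  · obtain ⟨g, rfl⟩ := (single _).map_surjective g
    have : injCogen k v ∘ₗ appLin g v = 0 := by
      ext m
      rw [← canonicalForm_comp m, injHom_eq]
      exact LinearMap.congr_fun hg _
    have hg₀ : g = 0 := (injHom_eq g).symm.trans ((congrArg injHom (this.trans
      (LinearMap.comp_zero (injCogen k v)).symm)).trans (injHom_eq 0))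
    rw [hg₀, Functor.map_zero]
  · let l : Module.Dual k (M.obj v) := L ∘ₗ projHomLin v M
    refine ⟨(single _).map (injHom l), LinearMap.ext fun f => ?_⟩
    obtain ⟨f, rfl⟩ := (single _).map_surjective f
    rw [← projHom_eq f, serreMap_apply, canonicalForm_comp]
    rfl

/-- On a module the duality is `serreLocus_single`; on its nonzero shifts both Hom spaces vanish.
The objects where duality holds for all shifts form a triangulated subcategory containing the
modules. -/
theorem isSerreDual_proj_inj (v : P) :
    IsSerreDual k ((single (PosetMod k P)).obj (projMod k v))
      ((single (PosetMod k P)).obj (injMod k v)) := by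
  refine ⟨canonicalForm v, fun Y => ?_⟩
  refine (serreLocus (canonicalForm v)).prop_of_iso ((shiftFunctorZero _ ℤ).app Y)
    (bounded_induction (shiftCore (serreLocus (canonicalForm v))) (fun M i => ?_) Y 0)
  rcases eq_or_ne i 0 with rfl | hi
  · exact (serreLocus _).prop_of_iso ((shiftFunctorZero _ ℤ).symm.app _) (serreLocus_single v M)
  · refine ⟨fun g g' _ => ?_, fun l => ⟨0, LinearMap.ext fun f => ?_⟩⟩
    · rw [shift_injective_eq_zero hi g, shift_injective_eq_zero hi g']
    · rw [shift_projective_eq_zero hi f, map_zero, map_zero]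

theorem finiteHomFrom_single (v : P) (M : PosetMod k P) :
    finiteHomFrom k ((single (PosetMod k P)).obj (projMod k v)) ((single _).obj M) :=
  Module.Finite.of_surjective _ (projHomLin_surjective v M)

theorem finiteHomFrom_proj (v : P) (Y : Bounded (PosetMod k P)) :
    finiteHomFrom k ((single _).obj (projMod k v)) Y := by
  refine (finiteHomFrom k _).prop_of_iso ((shiftFunctorZero _ ℤ).app Y)
    (bounded_induction (shiftCore (finiteHomFrom k _)) (fun M i => ?_) Y 0)
  rcases eq_or_ne i 0 with rfl | hi
  · exact (finiteHomFrom k _).prop_of_iso ((shiftFunctorZero _ ℤ).symm.app _)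
      (finiteHomFrom_single v M)
  · have : Subsingleton ((single _).obj (projMod k v) ⟶ ((single _).obj M)⟦i⟧) :=
      ⟨fun f f' => by rw [shift_projective_eq_zero hi f, shift_projective_eq_zero hi f']⟩
    exact Module.Finite.of_finite

/-- The objects with class in the range of `s` form a triangulated subcategory containing all
modules. -/
theorem class_hom_surjective {s : (P → ℤ) →+ K0 (Bounded (PosetMod k P))}
    (hs : ∀ M : PosetMod k P, K0.of ((single _).obj M) = s (fun v => dimVec M v)) :
    Function.Surjective s := fun x => by
  change x ∈ s.range
  induction x using K0.induction with
  | of X => exact bounded_induction (classMem s.range) (fun M => ⟨_, (hs M).symm⟩) X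
  | zero => exact zero_mem _
  | add x y hx hy => exact add_mem hx hy
  | neg x hx => exact neg_mem hx

theorem IsCoxeterTransformation.map_upVec
    {θ : AddMonoid.End (K0 (Bounded (PosetMod k P)))} (hθ : IsCoxeterTransformation k θ)
    {s : (P → ℤ) →+ K0 (Bounded (PosetMod k P))}
    (hs : ∀ M : PosetMod k P, K0.of ((single _).obj M) = s (fun v => dimVec M v)) (v : P) :
    θ (s (upVec v)) = -s (downVec v) := by
  rw [upVec_eq_dimVec k, downVec_eq_dimVec k, ← hs, ← hs]
  exact hθ.map_of (isSerreDual_proj_inj v)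

variable [Fintype P]

/-- The modules `P_v` generate the bounded derived category. -/
theorem bounded_devissage_proj (Q : ObjectProperty (Bounded (PosetMod k P)))
    [Q.IsClosedUnderIsomorphisms] [Q.IsTriangulated]
    (h : ∀ v, Q ((single _).obj (projMod k v))) (X : Bounded (PosetMod k P)) : Q X := by
  refine bounded_induction Q (devissage_proj (Q := fun M => Q ((single _).obj M))
    (fun M hM => ?_) (fun S hS h₁ h₃ => ?_) (fun S hS h₁ h₂ => ?_) h) X
  · exact Q.prop_of_isZero ((single _).map_isZero hM)
  · obtain ⟨δ, hδ⟩ := exists_single_distTriang hS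
    exact Q.ext_of_isTriangulatedClosed₂ _ hδ h₁ h₃
  · obtain ⟨δ, hδ⟩ := exists_single_distTriang hS
    exact Q.ext_of_isTriangulatedClosed₃ _ hδ h₁ h₂

/-- The modules `I_v` generate the bounded derived category. -/
theorem bounded_devissage_inj (Q : ObjectProperty (Bounded (PosetMod k P)))
    [Q.IsClosedUnderIsomorphisms] [Q.IsTriangulated]
    (h : ∀ v, Q ((single _).obj (injMod k v))) (X : Bounded (PosetMod k P)) : Q X := by
  refine bounded_induction Q (devissage_inj (Q := fun M => Q ((single _).obj M))
    (fun M hM => ?_) (fun S hS h₂ h₃ => ?_) (fun S hS h₁ h₃ => ?_) h) X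
  · exact Q.prop_of_isZero ((single _).map_isZero hM)
  · obtain ⟨δ, hδ⟩ := exists_single_distTriang hS
    exact Q.ext_of_isTriangulatedClosed₁ _ hδ h₂ h₃
  · obtain ⟨δ, hδ⟩ := exists_single_distTriang hS
    exact Q.ext_of_isTriangulatedClosed₂ _ hδ h₁ h₃

instance (X Y : Bounded (PosetMod k P)) : FiniteDimensional k (X ⟶ Y) :=
  bounded_devissage_proj (finiteHom _ k) finiteHomFrom_proj X Y

theorem exists_isSerreDual (X : Bounded (PosetMod k P)) : ∃ W, IsSerreDual k X W :=
  bounded_devissage_proj (hasSerreDual _ k) (fun v => ⟨_, isSerreDual_proj_inj v⟩) X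

theorem exists_isSerreDual' (W : Bounded (PosetMod k P)) : ∃ X, IsSerreDual k X W :=
  bounded_devissage_inj (isSomeSerreDual _ k) (fun v => ⟨_, isSerreDual_proj_inj v⟩) W

/-- A unitriangular system, solved by recursion from the top of the poset. With `p v` the class of
`P_v`, the solution `σ v` plays the role of the class of the simple module at `v`. -/
theorem exists_sum_upVec_smul {G : Type*} [AddCommGroup G] (p : P → G) :
    ∃ σ : P → G, ∀ v, ∑ w, (upVec v w : ℤ) • σ w = p v := by
  classical
  let F (v : P) (ih : ∀ w, w > v → G) : G :=
    p v - ∑ w : {w // w > v}, ih w.1 w.2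
  refine ⟨(wellFounded_gt (α := P)).fix F, fun v => ?_⟩
  have h := (wellFounded_gt (α := P)).fix_eq F v
  have h' : ∑ w : {w // w > v}, (wellFounded_gt (α := P)).fix F w.1 =
      ∑ w with v < w, (wellFounded_gt (α := P)).fix F w :=
    (Finset.sum_subtype _ (by simp) _).symm
  have h'' : (Finset.univ.filter fun w => v ≤ w) =
      insert v (Finset.univ.filter fun w => v < w) := by
    ext w
    simp [le_iff_eq_or_lt, eq_comm]
  replace h : (wellFounded_gt (α := P)).fix F v =
      p v - ∑ w : {w // w > v}, (wellFounded_gt (α := P)).fix F w.1 := h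
  rw [h', eq_sub_iff_add_eq] at h
  rw [← h]
  simp only [upVec, ite_smul, one_smul, zero_smul]
  rw [← Finset.sum_filter, h'', Finset.sum_insert (by simp)]

variable (k P) in
/-- The class of a module in the Grothendieck group depends linearly on its dimension vector. -/
theorem exists_class_hom : ∃ s : (P → ℤ) →+ K0 (Bounded (PosetMod k P)),
    ∀ M : PosetMod k P, K0.of ((single _).obj M) = s (fun v => dimVec M v) := by
  obtain ⟨σ, hσ⟩ := exists_sum_upVec_smul fun v : P =>
    K0.of ((single (PosetMod k P)).obj (projMod k v))
  let s : (P → ℤ) →+ K0 (Bounded (PosetMod k P)) :=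
    { toFun := fun f => ∑ v, f v • σ v
      map_zero' := by simp
      map_add' := fun f g => by simp [add_smul, Finset.sum_add_distrib] }
  have hs {S : ShortComplex (PosetMod k P)} (hS : S.ShortExact) :
      s (fun v => dimVec S.X₂ v) = s (fun v => dimVec S.X₁ v) + s (fun v => dimVec S.X₃ v) := by
    rw [← map_add]
    congr 1
    ext v
    simp [dimVec_of_shortExact hS v]
  have hK {S : ShortComplex (PosetMod k P)} (hS : S.ShortExact) :
      K0.of ((single _).obj S.X₂) = K0.of ((single _).obj S.X₁) + K0.of ((single _).obj S.X₃) := by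
    obtain ⟨δ, hδ⟩ := exists_single_distTriang hS
    exact K0.of_distTriang hδ
  -- Both sides are additive on short exact sequences, so agreement on the `P_v`, built into the
  -- choice of `σ`, is enough.
  refine ⟨s, devissage_proj (fun M hM => ?_) (fun S hS h₁ h₃ => ?_) (fun S hS h₁ h₂ => ?_)
    fun v => ?_⟩
  · rw [K0.of_isZero ((single _).map_isZero hM)]
    have : (fun v => (dimVec M v : ℤ)) = 0 := by
      ext v
      have : ∀ m : M.obj v, m = 0 := fun m =>
        congrArg (fun φ : M ⟶ M => appLin φ v m) (hM.eq_of_src (𝟙 M) 0)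
      have : Subsingleton (M.obj v) := ⟨fun m m' => by rw [this m, this m']⟩
      simp [dimVec, Module.finrank_zero_of_subsingleton]
    rw [this, map_zero]
  · rw [hK hS, hs hS, h₁, h₃]
  · have h := hK hS
    rw [h₁, h₂, hs hS] at h
    exact (add_left_cancel h).symm
  · rw [← hσ v]
    rw [upVec_eq_dimVec k]
    rfl

theorem existsUnique_coxeterTransformation :
    ∃! θ : AddMonoid.End (K0 (Bounded (PosetMod k P))), IsCoxeterTransformation k θ :=
  existsUnique_isCoxeterTransformation exists_isSerreDual exists_isSerreDual'

end DerivedPoset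

end TamariCoxeter

/-- The Coxeter transformation `θ` on the Grothendieck group of the bounded derived category of
modules over the Tamari lattice of degree `n` is well defined and satisfies `θ ^ (2 * n + 2) = 1`. -/
theorem corollary6p2 (k : Type u) [Field k] (n : ℕ)
    [HasDerivedCategory.{w} (TamariCoxeter.PosetMod k (TamariCoxeter.Tamari n))] :
    (∃! θ : AddMonoid.End (TamariCoxeter.K0
        (DerivedCategory.Bounded (TamariCoxeter.PosetMod k (TamariCoxeter.Tamari n)))),
      TamariCoxeter.IsCoxeterTransformation k θ) ∧
    ∀ θ : AddMonoid.End (TamariCoxeter.K0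
        (DerivedCategory.Bounded (TamariCoxeter.PosetMod k (TamariCoxeter.Tamari n)))),
      TamariCoxeter.IsCoxeterTransformation k θ → θ ^ (2 * n + 2) = 1 := by
  refine ⟨TamariCoxeter.existsUnique_coxeterTransformation, fun θ hθ => ?_⟩
  obtain ⟨s, hs⟩ := TamariCoxeter.exists_class_hom k (TamariCoxeter.Tamari n)
  exact TamariCoxeter.pow_eq_one_of_map_upVec s (TamariCoxeter.class_hom_surjective hs) θ
    (hθ.map_upVec hs)
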